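/- Let $\Sigma$ be a finite alphabet with $0,1\in\Sigma$. A multi-function $f:A\rightrightarrows B$ assigns to each $a\in A$ a set $f(a)\subseteq B$; $\mathrm{dom}(f)=\{a: f(a)\neq\emptyset\}$; $f'$ extends $f$ if $\mathrm{dom}(f)\subseteq\mathrm{dom}(f')$ and $f'(x)\subseteq f(x)$ for all $x\in\mathrm{dom}(f)$. A multi-represented set is a set $Z$ with a multi-function $\delta:\Sigma^\omega\rightrightarrows Z$ whose range is $Z$; if $z\in\delta(p)$, then $p$ is called a name of $z$. A partial function $F$ on $\Sigma^\omega$ realizes $c:Z_1\times\dots\times Z_n\rightrightarrows Z_0$ if, whenever $p_1,\dots,p_n$ are names of $y_1,\dots,y_n$ and $(y_1,\dots,y_n)\in\mathrm{dom}(c)$, $F(p_1,\dots,p_n)$ exists and is a name of some element of $c(y_1,\dots,y_n)$; $c$ is computable (continuous) if it has a computable (continuous) realization, where a partial function on $\Sigma^\omega$ is computable if some Type-2 machine computes an extension of it. The same is used for partial functions into $\Sigma^*$, a word being its own name. For $f:Z_1\rightrightarrows Z_2$ and $g:Z_3\rightrightarrows Z_4$, $f\le_W g$ means that there are computable partial functions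 $G,H$ on $\Sigma^\omega$ such that for every partial function $h$ on $\Sigma^\omega$ realizing $g$, the function $p\mapsto G(p,h(H(p)))$ realizes $f$. Continuous reducibility is defined with continuous $G,H$. A generalized Turing machine (GTM) $N$ has tapes $0,\dots,L$, where tapes $1,\dots,k$ are the input tapes and tape $0$ is the output tape. Each cell of tape $i$ contains an element of a set $X_i$ or a symbol of a finite work alphabet $\Gamma$ (disjoint from $X_i$, with a blank). There are finitely many labels, among them an initial label $l_0$ and a final label $l_f$. Each label $l\ne l_f$ carries a statement: move the head of a tape one cell to the right or left; write a symbol $a\in\Gamma$; branch on whether $a\in\Gamma$ is scanned; an assignment $(i:=c(i_1,\dots,i_n),l')$ with a multi-function $c:X_{i_1}\times\dots\times X_{i_n}\rightrightarrows X_i$, which writes any element of $c(x_{i_1},\dots,x_{i_n})$, where $x_j$ is the content of the scanned cell of tape $j$; or a test $(\text{if }t(i_1,\dots,i_n)\text{ then }l'\text{ else }l'')$ with a partial function $t$ from $X_{i_1}\times\dots\times X_{i_n}$ to $\Sigma^*$ with values in $\{0,1\}$ ($0$ means "then"). Initially the inputs are in cells $0$ of the input tapes, all other cells are blank, and all heads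 are on cell $0$. A computation is accepting if it is finite and ends with label $l_f$ and an element of $X_0$ (the result) in cell $0$ of tape $0$. One has $x_0\in f_N(x)$ iff every maximal computation on input $x$ is accepting and some accepting computation on input $x$ has result $x_0$. The directed graph $\mathrm{graph}(N)$ on the labels has an edge from $l\neq l_f$ to every next label that is named in the statement of $l$. **Theorem.** Let $f:Z_1\rightrightarrows Z_2$ and $g:Z_3\rightrightarrows Z_4$ be multi-functions on multi-represented sets such that $g$ is not computable. Let $N$ be a GTM with one input tape on multi-represented sets (each $X_i$ has a multi-representation $\delta_i$; those of tapes $1$ and $0$ are $Z_1$ and $Z_2$) such that 1. every test in $N$ is computable; 2. every assignment in $N$ either uses a computable multi-function or is of the form $(i:=g(i_1),l')$, where tapes $i_1$ and $i$ carry the multi-represented sets $Z_3$ and $Z_4$; 3. every path in $\mathrm{graph}(N)$ starting at $l_0$ visits at most once a label whose statement applies $g$; 4. $f_N$ extends $f$. Suppose moreover that some element of $\mathrm{dom}(g)$ has a computable name, or that every accepting computation of $N$ on an input from $\mathrm{dom}(f)$ visits a label whose statement applies $g$. Then $f\le_W g$. Likewise, if $g$ is not continuous and the conditions hold with "continuous"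 in place of "computable" in 1 and 2, then $f$ is continuously reducible to $g$; here the additional supposition is not needed. -/

import Mathlib

universe u

namespace GTMWeihrauch

/-! ### Multi-functions -/

/-- A multi-function from `α` to `β`: to every `a` the set of all acceptable results. -/
abbrev MultiFun (α : Type*) (β : Type*) := α → Set β

/-- The domain of a multi-function. -/
def MultiFun.dom {α β : Type*} (f : MultiFun α β) : Set α := {a | (f a).Nonempty}

/-- `f'` extends `f`: `dom f ⊆ dom f'`, and `f' x ⊆ f x` for all `x ∈ dom f`. -/
def MultiFun.Extends {α β : Type*} (f' f : MultiFun α β) : Prop :=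
  f.dom ⊆ f'.dom ∧ ∀ x ∈ f.dom, f' x ⊆ f x

/-! ### Words, sequences, and the functions on them

The alphabet is `Fin (s + 2)`: an arbitrary finite alphabet containing the symbols `0` and `1`. -/

/-- Finite words over the alphabet. -/
abbrev Word (s : ℕ) := List (Fin (s + 2))

/-- Infinite sequences over the alphabet; the topology is the Cantor (product) topology. -/
abbrev Seq (s : ℕ) := ℕ → Fin (s + 2)

/-- The prefix of length `m` of an infinite sequence. -/
def Seq.pre {s : ℕ} (p : Seq s) (m : ℕ) : Word s := (List.range m).map p

/-- The tuple of the prefixes of length `m` of a tuple of sequences. -/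
def preTuple {s n : ℕ} (p : Fin n → Seq s) (m : ℕ) : Fin n → Word s := fun j => (p j).pre m

/-- An `n`-ary partial function on sequences is computable if it has an extension computed by an
effective procedure with a one-way output tape: `out m u` is the finite word that has been
written after stage `m`, when `u` consists of the first `m` symbols of every input.  Outside of
the domain of `F` nothing but monotonicity is required of the output. -/
def SeqFunComputable {s n : ℕ} (F : (Fin n → Seq s) →. Seq s) : Prop :=
  ∃ out : ℕ → (Fin n → Word s) → Word s,
    Computable₂ out ∧
    (∀ p m, out m (preTuple p m) <+: out (m + 1) (preTuple p (m + 1))) ∧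
    ∀ p, ∀ q ∈ F p,
      (∀ m, out m (preTuple p m) = q.pre (out m (preTuple p m)).length) ∧
      (∀ k, ∃ m, k ≤ (out m (preTuple p m)).length)

/-- An `n`-ary partial function from sequences to words is computable if it has an extension
computed by an effective procedure that halts with the result: `out m u = some w` means that
the procedure has halted with result `w` by stage `m`, when `u` consists of the first `m`
symbols of every input. -/
def WordFunComputable {s n : ℕ} (F : (Fin n → Seq s) →. Word s) : Prop :=
  ∃ out : ℕ → (Fin n → Word s) → Option (Word s),
    Computable₂ out ∧
    (∀ p m w, out m (preTuple p m) = some w → out (m + 1) (preTuple p (m + 1)) = some w) ∧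
    ∀ p, ∀ w ∈ F p, ∃ m, out m (preTuple p m) = some w

/-- Continuity of a partial function on sequences (on its domain, with the subspace topology). -/
def SeqFunContinuous {s n : ℕ} (F : (Fin n → Seq s) →. Seq s) : Prop :=
  Continuous F.asSubtype

/-- Continuity of a partial function from sequences to the discrete space of words. -/
def WordFunContinuous {s n : ℕ} (F : (Fin n → Seq s) →. Word s) : Prop :=
  IsLocallyConstant F.asSubtype

/-! ### Multi-represented sets, realization, computability, reducibility -/

/-- A set with a multi-representation: `x ∈ rep p` means that `p` is a name of `x`; a sequence
may be a name of several elements (or of none), and every element has a name. -/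
structure MRSet (s : ℕ) where
  carrier : Type u
  rep : Seq s → Set carrier
  surj : ∀ x, ∃ p, x ∈ rep p

instance (s : ℕ) : CoeSort (MRSet.{u} s) (Type u) := ⟨MRSet.carrier⟩

/-- A multi-function of several arguments on multi-represented sets, together with these sets. -/
structure MFun (s : ℕ) where
  arity : ℕ
  source : Fin arity → MRSet.{u} s
  target : MRSet.{u} s
  fn : MultiFun (∀ j, source j) target

/-- A multi-function of one argument as an `MFun`. -/
def unary {s : ℕ} {S T : MRSet.{u} s} (f : MultiFun S T) : MFun.{u} s where
  arity := 1
  source := fun _ => S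
  target := T
  fn := fun v => f (v 0)

/-- The partial function `F` on names realizes the multi-function `c`. -/
def MFun.RealizedBy {s : ℕ} (c : MFun.{u} s) (F : (Fin c.arity → Seq s) →. Seq s) : Prop :=
  ∀ (p : Fin c.arity → Seq s) (y : ∀ j, c.source j), (∀ j, y j ∈ (c.source j).rep (p j)) →
    y ∈ c.fn.dom → (F p).Dom ∧ ∀ q ∈ F p, ∃ z ∈ c.fn y, z ∈ c.target.rep q

/-- `c` is computable with respect to the given multi-representations. -/
def MFun.IsComputable {s : ℕ} (c : MFun.{u} s) : Prop :=
  ∃ F, SeqFunComputable F ∧ c.RealizedBy F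

/-- `c` is continuous with respect to the given multi-representations. -/
def MFun.IsContinuous {s : ℕ} (c : MFun.{u} s) : Prop :=
  ∃ F, SeqFunContinuous F ∧ c.RealizedBy F

/-- The partial function `F` realizes the word-valued partial function `t`, where words are
represented by themselves. -/
def TestRealizedBy {s n : ℕ} (S : Fin n → MRSet.{u} s) (t : (∀ j, S j) →. Word s)
    (F : (Fin n → Seq s) →. Word s) : Prop :=
  ∀ (p : Fin n → Seq s) (y : ∀ j, S j), (∀ j, y j ∈ (S j).rep (p j)) → ∀ w ∈ t y, w ∈ F p

/-- `t` is computable with respect to the given multi-representations. -/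
def TestComputable {s n : ℕ} (S : Fin n → MRSet.{u} s) (t : (∀ j, S j) →. Word s) : Prop :=
  ∃ F, WordFunComputable F ∧ TestRealizedBy S t F

/-- `t` is continuous with respect to the given multi-representations. -/
def TestContinuous {s n : ℕ} (S : Fin n → MRSet.{u} s) (t : (∀ j, S j) →. Word s) : Prop :=
  ∃ F, WordFunContinuous F ∧ TestRealizedBy S t F

/-- The partial function `p ↦ G (p, h (H p))` on sequences. -/
def reductionFun {s : ℕ} (G : (Fin 2 → Seq s) →. Seq s) (H h : (Fin 1 → Seq s) →. Seq s) :
    (Fin 1 → Seq s) →. Seq s :=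
  fun p => (H p).bind fun q => (h ![q]).bind fun r => G ![p 0, r]

/-- `G` and `H` reduce `f` to `g`: for every partial function `h` realizing `g`, the function
`p ↦ G (p, h (H p))` realizes `f`. -/
def IsReduction {s : ℕ} {S₁ S₂ S₃ S₄ : MRSet.{u} s} (G : (Fin 2 → Seq s) →. Seq s)
    (H : (Fin 1 → Seq s) →. Seq s) (f : MultiFun S₁ S₂) (g : MultiFun S₃ S₄) : Prop :=
  ∀ h : (Fin 1 → Seq s) →. Seq s,
    (unary g).RealizedBy h → (unary f).RealizedBy (reductionFun G H h)

/-- Weihrauch reducibility `f ≤_W g`. -/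
def WeihrauchLE {s : ℕ} {S₁ S₂ S₃ S₄ : MRSet.{u} s} (f : MultiFun S₁ S₂) (g : MultiFun S₃ S₄) :
    Prop :=
  ∃ G H, SeqFunComputable G ∧ SeqFunComputable H ∧ IsReduction G H f g

/-- Continuous Weihrauch reducibility. -/
def ContWeihrauchLE {s : ℕ} {S₁ S₂ S₃ S₄ : MRSet.{u} s} (f : MultiFun S₁ S₂)
    (g : MultiFun S₃ S₄) : Prop :=
  ∃ G H, SeqFunContinuous G ∧ SeqFunContinuous H ∧ IsReduction G H f g

/-! ### Generalized Turing machines -/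

/-- The statements of a generalized Turing machine with tapes `0, …, L`, where `X i` is the set
of tape `i`, `Γ` is the work alphabet and `Λ` is the set of labels. -/
inductive Stmt (s : ℕ) {L : ℕ} (X : Fin (L + 1) → Type u) (Γ Λ : Type) : Type u
  /-- Move the head of tape `i` one cell to the right. -/
  | right (i : Fin (L + 1)) (l : Λ)
  /-- Move the head of tape `i` one cell to the left. -/
  | left (i : Fin (L + 1)) (l : Λ)
  /-- Write the symbol `a` on tape `i`. -/
  | write (i : Fin (L + 1)) (a : Γ) (l : Λ)
  /-- Branch on whether the symbol `a` is scanned on tape `i`. -/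
  | ifSymbol (i : Fin (L + 1)) (a : Γ) (l l' : Λ)
  /-- `(i := c(i₁, …, iₙ), l)` for a multi-function `c`. -/
  | assign (i : Fin (L + 1)) {n : ℕ} (src : Fin n → Fin (L + 1))
      (c : MultiFun (∀ j, X (src j)) (X i)) (l : Λ)
  /-- `(if t(i₁, …, iₙ) then l, else l')` for a partial word function `t` with values in
  `{0, 1}`. -/
  | test {n : ℕ} (src : Fin n → Fin (L + 1)) (t : (∀ j, X (src j)) →. Word s)
      (range_subset : ∀ v, ∀ w ∈ t v, w = [0] ∨ w = [1]) (l l' : Λ)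

/-- The possible next labels of a statement. -/
def Stmt.targets {s L : ℕ} {X : Fin (L + 1) → Type u} {Γ Λ : Type} : Stmt s X Γ Λ → Set Λ
  | .right _ l => {l}
  | .left _ l => {l}
  | .write _ _ l => {l}
  | .ifSymbol _ _ l l' => {l, l'}
  | .assign _ _ _ l => {l}
  | .test _ _ _ l l' => {l, l'}

/-- A generalized Turing machine with tapes `0, …, L`. -/
structure GTM (s : ℕ) {L : ℕ} (X : Fin (L + 1) → Type u) where
  /-- The labels. -/
  Label : Type
  finite_label : Finite Label
  start : Label
  final : Label
  /-- The work alphabet. -/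
  Γ : Type
  finite_Γ : Finite Γ
  blank : Γ
  /-- The number of input tapes; these are the tapes `1, …, k`. -/
  k : ℕ
  k_le : k ≤ L
  stm : (l : Label) → l ≠ final → Stmt s X Γ Label

namespace GTM

variable {s L : ℕ} {X : Fin (L + 1) → Type u}

/-- The `j`-th input tape; counting from `j = 0`, this is tape `j + 1`. -/
def inputTape (N : GTM s X) (j : Fin N.k) : Fin (L + 1) := (Fin.castLE N.k_le j).succ

/-- A configuration: a label, the inscriptions of the tapes and the positions of the heads. -/
structure Config (N : GTM s X) where
  label : N.Label
  tape : ∀ i, ℤ → X i ⊕ N.Γ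
  head : Fin (L + 1) → ℤ

variable {N : GTM s X}

/-- The content of the cell scanned on tape `i`. -/
def Config.scan (κ : N.Config) (i : Fin (L + 1)) : X i ⊕ N.Γ := κ.tape i (κ.head i)

/-- Replace the label. -/
def Config.goto (κ : N.Config) (l : N.Label) : N.Config := { κ with label := l }

/-- Move the head of tape `i` by `d` cells. -/
def Config.move (κ : N.Config) (i : Fin (L + 1)) (d : ℤ) : N.Config :=
  { κ with head := Function.update κ.head i (κ.head i + d) }

/-- Write `x` on the cell scanned on tape `i`. -/
def Config.put (κ : N.Config) (i : Fin (L + 1)) (x : X i ⊕ N.Γ) : N.Config :=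
  { κ with tape := Function.update κ.tape i (Function.update (κ.tape i) (κ.head i) x) }

/-- `κ'` is a possible result of executing a statement in configuration `κ`. -/
def Exec (κ κ' : N.Config) : Stmt s X N.Γ N.Label → Prop
  | .right i l => κ' = (κ.move i 1).goto l
  | .left i l => κ' = (κ.move i (-1)).goto l
  | .write i a l => κ' = (κ.put i (Sum.inr a)).goto l
  | .ifSymbol i a l l' =>
      (κ.scan i = Sum.inr a ∧ κ' = κ.goto l) ∨ (κ.scan i ≠ Sum.inr a ∧ κ' = κ.goto l')
  | .assign i src c l =>
      ∃ v : ∀ j, X (src j), (∀ j, κ.scan (src j) = Sum.inl (v j)) ∧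
        ∃ x ∈ c v, κ' = (κ.put i (Sum.inl x)).goto l
  | .test src t _ l l' =>
      ∃ v : ∀ j, X (src j), (∀ j, κ.scan (src j) = Sum.inl (v j)) ∧
        (([0] ∈ t v ∧ κ' = κ.goto l) ∨ ([1] ∈ t v ∧ κ' = κ.goto l'))

/-- The successor relation on configurations. -/
def Step (κ κ' : N.Config) : Prop :=
  ∃ h : κ.label ≠ N.final, Exec κ κ' (N.stm κ.label h)

variable (N)

/-- The initial configuration: `x j` is in cell `0` of the `j`-th input tape, all other cells are
blank, and all heads are on position `0`. -/
def init (x : ∀ j : Fin N.k, X (N.inputTape j)) : N.Config where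
  label := N.start
  tape := Fin.cases (fun _ => Sum.inr N.blank)
    (fun j m => if h : m = 0 ∧ j.val < N.k then Sum.inl (x ⟨j.val, h.2⟩) else Sum.inr N.blank)
  head := fun _ => 0

variable {N}

/-- `x` is the result of the accepting configuration `κ`: the label is final and `x` is in cell
`0` of the output tape. -/
def Config.Accepts (κ : N.Config) (x : X 0) : Prop :=
  κ.label = N.final ∧ κ.tape 0 0 = Sum.inl x

/-- `c 0, …, c n` is a (finite) computation with first configuration `κ`. -/
def FinComputation (κ : N.Config) (c : ℕ → N.Config) (n : ℕ) : Prop :=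
  c 0 = κ ∧ ∀ i < n, Step (c i) (c (i + 1))

/-- `c 0, c 1, …` is an infinite computation with first configuration `κ`. -/
def InfComputation (κ : N.Config) (c : ℕ → N.Config) : Prop :=
  c 0 = κ ∧ ∀ i, Step (c i) (c (i + 1))

variable (N)

/-- The multi-function `f_N` computed by `N`: `x₀ ∈ f_N x` iff every maximal computation on
input `x` is (finite and) accepting, and there is an accepting computation with result `x₀`. -/
def compute : MultiFun (∀ j : Fin N.k, X (N.inputTape j)) (X 0) := fun x => {x₀ |
  ((¬ ∃ c, InfComputation (N.init x) c) ∧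
    ∀ c n, FinComputation (N.init x) c n → (∀ κ, ¬ Step (c n) κ) → ∃ y, (c n).Accepts y) ∧
  ∃ c n, FinComputation (N.init x) c n ∧ (c n).Accepts x₀}

/-- The edges of `graph(N)`. -/
def Edge (l l' : N.Label) : Prop := ∃ h : l ≠ N.final, l' ∈ (N.stm l h).targets

/-- `π 0, …, π n` is a path in `graph(N)` that starts at the initial label. -/
def IsPath (π : ℕ → N.Label) (n : ℕ) : Prop :=
  π 0 = N.start ∧ ∀ i < n, N.Edge (π i) (π (i + 1))

end GTM

/-! ### Machines on multi-represented sets -/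

section OnMRSets

variable {s L : ℕ} {Z : Fin (L + 1) → MRSet.{u} s}

/-- The statement is `(i := g(i₁), l')`; that is, it is an assignment whose multi-function,
together with the multi-represented sets of the tapes involved, is `g`. -/
def Stmt.Applies {Γ Λ : Type} {S₃ S₄ : MRSet.{u} s} (g : MultiFun S₃ S₄) :
    Stmt s (fun i => (Z i).carrier) Γ Λ → Prop
  | .assign i src c _ => (⟨_, fun j => Z (src j), Z i, c⟩ : MFun.{u} s) = unary g
  | _ => False

/-- Assignments use only multi-functions with the property `P`. -/
def Stmt.AssignSat {Γ Λ : Type} (P : MFun.{u} s → Prop) :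
    Stmt s (fun i => (Z i).carrier) Γ Λ → Prop
  | .assign i src c _ => P ⟨_, fun j => Z (src j), Z i, c⟩
  | _ => True

/-- Tests use only partial functions with the property `P`. -/
def Stmt.TestSat {Γ Λ : Type}
    (P : ∀ {n : ℕ} (S : Fin n → MRSet.{u} s), ((∀ j, S j) →. Word s) → Prop) :
    Stmt s (fun i => (Z i).carrier) Γ Λ → Prop
  | .test src t _ _ _ => P (fun j => Z (src j)) t
  | _ => True

variable (N : GTM s (fun i => (Z i).carrier)) {S₃ S₄ : MRSet.{u} s} (g : MultiFun S₃ S₄)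

/-- The label `l` applies `g`. -/
def GTM.LabelApplies (l : N.Label) : Prop := ∃ h : l ≠ N.final, (N.stm l h).Applies g

/-- Every path in `graph(N)` from the initial label visits at most once a label applying `g`. -/
def GTM.AppliesAtMostOnce : Prop :=
  ∀ π n, N.IsPath π n → ∀ i ≤ n, ∀ j ≤ n,
    N.LabelApplies g (π i) → N.LabelApplies g (π j) → i = j

/-- Every accepting computation on an input from `D` visits a label applying `g`. -/
def GTM.AlwaysApplies (D : Set (∀ j : Fin N.k, Z (N.inputTape j))) : Prop :=
  ∀ x ∈ D, ∀ c n, GTM.FinComputation (N.init x) c n → (∃ y, (c n).Accepts y) →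
    ∃ i ≤ n, N.LabelApplies g (c i).label

/-- Every test in `N` is computable. -/
def GTM.TestsComputable : Prop := ∀ l h, (N.stm l h).TestSat TestComputable

/-- Every test in `N` is continuous. -/
def GTM.TestsContinuous : Prop := ∀ l h, (N.stm l h).TestSat TestContinuous

/-- Every assignment in `N` is computable or applies `g`. -/
def GTM.AssignsComputableOr : Prop :=
  ∀ l h, (N.stm l h).AssignSat MFun.IsComputable ∨ (N.stm l h).Applies g

/-- Every assignment in `N` is continuous or applies `g`. -/
def GTM.AssignsContinuousOr : Prop :=
  ∀ l h, (N.stm l h).AssignSat MFun.IsContinuous ∨ (N.stm l h).Applies g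

/-- Some element of `dom g` has a computable name. -/
def HasComputablePoint : Prop := ∃ y ∈ g.dom, ∃ p : Seq s, Computable p ∧ y ∈ S₃.rep p

end OnMRSets

end GTMWeihrauch

namespace GTMWeihrauch

open Filter Topology

/-! ### Prefixes of sequences -/

section Prefixes

variable {s n : ℕ}

/-! The machine is simulated on names: a cell holding an element holds a name instead, computable
(continuous) assignments and tests are replaced by realizers, and an application of `g` becomes a
question to an oracle. The realizers select one of the many computations that `N` admits. Since the
input lies in the domain of `f_N`, this computation can neither get stuck nor run forever, and
whichever it is, its result lies in `f_N x`, hence in `f x`. As a path applies `g` at most once, one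
question suffices: `H` simulates up to the application and outputs the name scanned there; `G`
repeats the simulation, inserts the answer and continues to the final label.

If the simulation ends without a question, `h (H p)` must still be defined, so `H` then outputs a
default `p₀`, which should name an element of `dom g`. In the computable half `p₀` must be
computable; if the machine always asks, any computable sequence will do. In the continuous half any
name serves, and one exists because a `g` with empty domain is realized by the nowhere defined
function.

Names are infinite, so the simulation works on words: stage `m` restarts everything on prefixes of
length `m` and makes `m` steps. Two facts make this a one-way computation. Longer words lead to the
same labels and head positions and to longer cell contents, so the output only grows, even on
sequences outside the domain (`exec_mono`, `run_mono`, `prefix_of_run`). And after a fixed number of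
steps the contents converge, as `m → ∞`, to names of the contents in a genuine computation of `N`
(`exists_exec_of_tracks`, `exists_run_of_tracks`). `exists_mem_reductionFun` joins the two phases.
The same construction covers continuity, because continuous functions also have monotone
approximations on words (`SeqFunContinuous.approxSeq`). -/

@[simp] theorem Seq.length_pre (p : Seq s) (m : ℕ) : (p.pre m).length = m := by
  simp [Seq.pre]

theorem Seq.take_pre (p : Seq s) (k m : ℕ) : (p.pre m).take k = p.pre (min k m) := by
  simp [Seq.pre, ← List.map_take, List.take_range]

theorem Seq.pre_succ (p : Seq s) (m : ℕ) : p.pre (m + 1) = p.pre m ++ [p m] := by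
  simp [Seq.pre, List.range_succ]

theorem Seq.pre_prefix_pre (p : Seq s) {k m : ℕ} (h : k ≤ m) : p.pre k <+: p.pre m := by
  have := Seq.take_pre p k m
  rw [min_eq_left h] at this
  rw [← this]
  exact List.take_prefix _ _

theorem Seq.pre_eq_pre_iff {p q : Seq s} {m : ℕ} : p.pre m = q.pre m ↔ ∀ i < m, p i = q i := by
  simp [Seq.pre]

theorem take_preTuple (p : Fin n → Seq s) {k m : ℕ} (h : k ≤ m) :
    (fun j => (preTuple p m j).take k) = preTuple p k := by
  funext j
  simp [preTuple, Seq.take_pre, min_eq_left h]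

theorem preTuple_eq_iff {p q : Fin n → Seq s} {m : ℕ} :
    preTuple p m = preTuple q m ↔ ∀ j, ∀ i < m, p j i = q j i := by
  simp [funext_iff, preTuple, Seq.pre_eq_pre_iff]

/-- The word `w` is a prefix of the sequence `q`. -/
def IsPre (w : Word s) (q : Seq s) : Prop := w = q.pre w.length

theorem isPre_pre (q : Seq s) (m : ℕ) : IsPre (q.pre m) q := by simp [IsPre]

theorem isPre_nil (q : Seq s) : IsPre [] q := by simp [IsPre, Seq.pre]

theorem IsPre.take_eq {w : Word s} {q : Seq s} (h : IsPre w q) {k : ℕ} (hk : k ≤ w.length) :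
    w.take k = q.pre k := by
  rw [h, Seq.take_pre, min_eq_left hk]

theorem IsPre.of_prefix {w w' : Word s} {q : Seq s} (h : IsPre w' q) (hw : w <+: w') :
    IsPre w q := by
  have h1 := List.prefix_iff_eq_take.1 hw
  rw [h.take_eq hw.length_le] at h1
  exact h1

theorem IsPre.getElem_eq {w : Word s} {q : Seq s} (h : IsPre w q) {k : ℕ} (hk : k < w.length) :
    w[k] = q k := by
  have : w[k]? = (q.pre w.length)[k]? := congrArg (·[k]?) h
  simp [Seq.pre, hk] at this
  exact this

theorem IsPre.concat {w : Word s} {q : Seq s} (h : IsPre w q) : IsPre (w ++ [q w.length]) q := by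
  unfold IsPre
  rw [List.length_append, List.length_singleton, Seq.pre_succ, ← h]

/-- A sequence with prefix `w`. -/
def Word.toSeq (w : Word s) : Seq s := fun i => w.getD i 0

theorem Word.isPre_toSeq (w : Word s) : IsPre w (Word.toSeq w) := by
  unfold IsPre
  refine List.ext_getElem (by simp) fun i h _ => ?_
  simp [Seq.pre, Word.toSeq, h]

/-- The words `w m` converge to the sequence `q`. -/
def Conv (w : ℕ → Word s) (q : Seq s) : Prop :=
  (∀ᶠ m in atTop, IsPre (w m) q) ∧ Tendsto (fun m => (w m).length) atTop atTop

theorem conv_pre (q : Seq s) : Conv (fun m => q.pre m) q :=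
  ⟨Eventually.of_forall fun m => isPre_pre q m, by
    simp only [Seq.length_pre]
    exact tendsto_id⟩

theorem Conv.unique {w : ℕ → Word s} {q q' : Seq s} (h : Conv w q) (h' : Conv w q') : q = q' := by
  funext k
  obtain ⟨m, h1, h2, h3⟩ :=
    (h.1.and (h'.1.and (h.2.eventually (eventually_gt_atTop k)))).exists
  rw [← h1.getElem_eq h3, ← h2.getElem_eq h3]

theorem Conv.congr {w w' : ℕ → Word s} {q : Seq s} (h : Conv w q) (e : ∀ᶠ m in atTop, w m = w' m) :
    Conv w' q := by
  refine ⟨?_, h.2.congr' ?_⟩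
  · filter_upwards [h.1, e] with m h1 h2
    rwa [← h2]
  · filter_upwards [e] with m h2
    rw [h2]

end Prefixes

/-! ### Approximation of partial functions on sequences by functions on words -/

section Approx

variable {s n : ℕ} {α : Type*}

/-- The output of the procedure `out` never shrinks. -/
def MonoSeq (out : ℕ → (Fin n → Word s) → Word s) : Prop :=
  ∀ p m, out m (preTuple p m) <+: out (m + 1) (preTuple p (m + 1))

/-- The result of the procedure `out` never changes. -/
def MonoWord (out : ℕ → (Fin n → Word s) → Option (Word s)) : Prop :=
  ∀ p m w, out m (preTuple p m) = some w → out (m + 1) (preTuple p (m + 1)) = some w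

/-- The procedure `out` computes an extension of `F`. -/
def ApproxSeq (F : (Fin n → Seq s) →. Seq s) (out : ℕ → (Fin n → Word s) → Word s) : Prop :=
  MonoSeq out ∧ ∀ p, ∀ q ∈ F p, (∀ m, IsPre (out m (preTuple p m)) q) ∧
    ∀ k, ∃ m, k ≤ (out m (preTuple p m)).length

/-- The procedure `out` computes an extension of the word-valued function `F`. -/
def ApproxWord (F : (Fin n → Seq s) →. Word s) (out : ℕ → (Fin n → Word s) → Option (Word s)) :
    Prop :=
  MonoWord out ∧ ∀ p, ∀ w ∈ F p, ∃ m, out m (preTuple p m) = some w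

theorem MonoSeq.prefix_of_le {out : ℕ → (Fin n → Word s) → Word s} (h : MonoSeq out)
    (p : Fin n → Seq s) {k m : ℕ} (hkm : k ≤ m) :
    out k (preTuple p k) <+: out m (preTuple p m) := by
  induction m, hkm using Nat.le_induction with
  | base => exact List.prefix_rfl
  | succ m _ ih => exact ih.trans (h p m)

theorem MonoWord.of_le {out : ℕ → (Fin n → Word s) → Option (Word s)} (h : MonoWord out)
    (p : Fin n → Seq s) {k m : ℕ} (hkm : k ≤ m) {w : Word s} (hw : out k (preTuple p k) = some w) :
    out m (preTuple p m) = some w := by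
  induction m, hkm using Nat.le_induction with
  | base => exact hw
  | succ m _ ih => exact h p m w ih

theorem ApproxSeq.conv {F : (Fin n → Seq s) →. Seq s} {out : ℕ → (Fin n → Word s) → Word s}
    (h : ApproxSeq F out) {p : Fin n → Seq s} {q : Seq s} (hq : q ∈ F p) :
    Conv (fun m => out m (preTuple p m)) q :=
  ⟨Eventually.of_forall (h.2 p q hq).1,
    tendsto_atTop_atTop_of_monotone (fun _ _ hab => (h.1.prefix_of_le p hab).length_le)
      (h.2 p q hq).2⟩

/-- The partial function computed by the procedure `out`. -/
noncomputable def fromOut (out : ℕ → (Fin n → Word s) → Word s) : (Fin n → Seq s) →. Seq s :=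
  fun p => ⟨∃ q, Conv (fun m => out m (preTuple p m)) q, fun h => h.choose⟩

theorem mem_fromOut {out : ℕ → (Fin n → Word s) → Word s} {p : Fin n → Seq s} {q : Seq s} :
    q ∈ fromOut out p ↔ Conv (fun m => out m (preTuple p m)) q := by
  constructor
  · rintro ⟨h, rfl⟩
    exact h.choose_spec
  · intro h
    exact ⟨⟨q, h⟩, Conv.unique (Exists.choose_spec (⟨q, h⟩ : ∃ q, _)) h⟩

/-- `Conv` constrains only late outputs; since each output is a prefix of all later ones, the early
ones are prefixes of the limit too. -/
theorem approxSeq_fromOut {out : ℕ → (Fin n → Word s) → Word s} (h : MonoSeq out) :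
    ApproxSeq (fromOut out) out := by
  refine ⟨h, fun p q hq => ?_⟩
  rw [mem_fromOut] at hq
  refine ⟨fun m => ?_, fun k => (hq.2.eventually (eventually_ge_atTop k)).exists⟩
  obtain ⟨m', h1, h2⟩ := (hq.1.and (eventually_ge_atTop m)).exists
  exact h1.of_prefix (h.prefix_of_le p h2)

theorem ApproxSeq.seqFunComputable {F : (Fin n → Seq s) →. Seq s}
    {out : ℕ → (Fin n → Word s) → Word s} (h : ApproxSeq F out) (hc : Computable₂ out) :
    SeqFunComputable F :=
  ⟨out, hc, h⟩

theorem SeqFunComputable.exists_approx {F : (Fin n → Seq s) →. Seq s} (h : SeqFunComputable F) :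
    ∃ out, Computable₂ out ∧ ApproxSeq F out :=
  h

theorem WordFunComputable.exists_approx {F : (Fin n → Seq s) →. Word s}
    (h : WordFunComputable F) : ∃ out, Computable₂ out ∧ ApproxWord F out :=
  h

/-! ### Approximation of continuous functions -/

theorem eventually_preTuple_eq (p : Fin n → Seq s) (m : ℕ) :
    ∀ᶠ p' in 𝓝 p, preTuple p' m = preTuple p m := by
  simp only [preTuple_eq_iff]
  refine eventually_all.2 fun j => ?_
  have : ∀ i, ∀ᶠ p' : Fin n → Seq s in 𝓝 p, p' j i = p j i := fun i => by
    have hc : Continuous fun p' : Fin n → Seq s => p' j i :=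
      (continuous_apply i).comp (continuous_apply j)
    have := hc.tendsto p
    rwa [nhds_discrete (Fin (s + 2)), tendsto_pure] at this
  exact (Set.finite_lt_nat m).eventually_all.2 fun i _ => this i

/-- Otherwise there are points of `D` agreeing with `p` up to `m` but with another value; they
converge to `p`, against local constancy. -/
theorem exists_preTuple_of_isLocallyConstant {D : Set (Fin n → Seq s)} {f : D → α}
    (hf : IsLocallyConstant f) (p : D) :
    ∃ m, ∀ p' : D, preTuple p'.1 m = preTuple p.1 m → f p' = f p := by
  by_contra! hcon
  choose p' h1 h2 using hcon
  have hlim : Tendsto p' atTop (𝓝 p) := by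
    rw [tendsto_subtype_rng, tendsto_pi_nhds]
    intro j
    rw [tendsto_pi_nhds]
    intro i
    refine tendsto_const_nhds.congr' ?_
    filter_upwards [eventually_gt_atTop i] with m hm
    exact (preTuple_eq_iff.1 (h1 m) j i hm).symm
  obtain ⟨m, hm⟩ := (hlim.eventually ((IsLocallyConstant.iff_eventually_eq f).1 hf p)).exists
  exact h2 m hm

/-- Symbol `i` of the value already occurs in a finite output, which depends on finitely many
symbols of the arguments. -/
theorem ApproxSeq.seqFunContinuous {F : (Fin n → Seq s) →. Seq s}
    {out : ℕ → (Fin n → Word s) → Word s} (h : ApproxSeq F out) : SeqFunContinuous F := by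
  refine continuous_pi fun i => IsLocallyConstant.continuous ?_
  rw [IsLocallyConstant.iff_eventually_eq]
  intro p
  have hF : ∀ x : F.Dom, F.asSubtype x ∈ F x.1 := fun x => Part.get_mem _
  obtain ⟨m, hm⟩ := (h.2 p.1 _ (hF p)).2 (i + 1)
  have := (continuous_subtype_val.tendsto p).eventually (eventually_preTuple_eq p.1 m)
  filter_upwards [this] with p' hp'
  rw [← ((h.2 p.1 _ (hF p)).1 m).getElem_eq hm]
  have h2 := ((h.2 p'.1 _ (hF p')).1 m)
  rw [hp'] at h2
  rw [h2.getElem_eq hm]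

open Classical in
/-- The longest output known from the prefixes `u` of the arguments of `F`, extended by at most
one symbol in every stage. -/
noncomputable def seqApprox (F : (Fin n → Seq s) →. Seq s) : ℕ → (Fin n → Word s) → Word s
  | 0, _ => []
  | m + 1, u =>
    let w := seqApprox F m fun j => (u j).take m
    if h : ∃ a, ∀ p, preTuple p (m + 1) = u → ∀ q ∈ F p, q w.length = a then w ++ [h.choose] else w

theorem seqApprox_succ (F : (Fin n → Seq s) →. Seq s) (p : Fin n → Seq s) (m : ℕ) :
    (seqApprox F (m + 1) (preTuple p (m + 1)) = seqApprox F m (preTuple p m) ∧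
      ¬ ∃ a, ∀ p', preTuple p' (m + 1) = preTuple p (m + 1) → ∀ q ∈ F p',
        q (seqApprox F m (preTuple p m)).length = a) ∨
    ∃ a, seqApprox F (m + 1) (preTuple p (m + 1)) = seqApprox F m (preTuple p m) ++ [a] ∧
      ∀ q ∈ F p, q (seqApprox F m (preTuple p m)).length = a := by
  rw [seqApprox, take_preTuple p (Nat.le_succ m)]
  by_cases h : ∃ a, ∀ p', preTuple p' (m + 1) = preTuple p (m + 1) → ∀ q ∈ F p',
        q (seqApprox F m (preTuple p m)).length = a
  · right
    refine ⟨h.choose, ?_, h.choose_spec p rfl⟩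
    simp only [dif_pos h]
  · left
    refine ⟨?_, h⟩
    simp only [dif_neg h]

/-- Each symbol of the value is locally constant on the domain, so a finite part of the arguments
forces it. Outside the domain arbitrary symbols may be appended, but the append-only form keeps the
output monotone there. -/
theorem SeqFunContinuous.approxSeq {F : (Fin n → Seq s) →. Seq s} (hF : SeqFunContinuous F) :
    ApproxSeq F (seqApprox F) := by
  have hmono : MonoSeq (seqApprox F) := by
    intro p m
    rcases seqApprox_succ F p m with ⟨h, -⟩ | ⟨a, h, -⟩ <;> rw [h]
    exact List.prefix_append _ _
  refine ⟨hmono, fun p q hq => ?_⟩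
  have hpre : ∀ m, IsPre (seqApprox F m (preTuple p m)) q := by
    intro m
    induction m with
    | zero => exact isPre_nil q
    | succ m ih =>
      rcases seqApprox_succ F p m with ⟨h, -⟩ | ⟨a, h, ha⟩
      · rwa [h]
      · rw [h, ← ha q hq]
        exact ih.concat
  refine ⟨hpre, fun k => ?_⟩
  induction k with
  | zero => exact ⟨0, Nat.zero_le _⟩
  | succ k ih =>
    obtain ⟨m, hm⟩ := ih
    have hlc : IsLocallyConstant fun x : F.Dom => F.asSubtype x k :=
      (IsLocallyConstant.iff_continuous _).2 ((continuous_apply k).comp hF)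
    have hp : p ∈ F.Dom := Part.dom_iff_mem.2 ⟨q, hq⟩
    obtain ⟨m0, hm0⟩ := exists_preTuple_of_isLocallyConstant hlc ⟨p, hp⟩
    have hm1 : k ≤ (seqApprox F (max m m0) (preTuple p (max m m0))).length :=
      hm.trans (hmono.prefix_of_le p (le_max_left m m0)).length_le
    refine ⟨max m m0 + 1, ?_⟩
    rcases seqApprox_succ F p (max m m0) with ⟨h, hn⟩ | ⟨a, h, -⟩
    · rcases hm1.lt_or_eq with hlt | heq
      · rw [h]
        exact hlt
      -- Exactly `k` symbols have been output, and the prefixes of length `m0` force symbol `k`, so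
      -- the procedure would have appended it.
      · refine absurd ⟨F.asSubtype ⟨p, hp⟩ k, fun p' hp' q' hq' => ?_⟩ hn
        have hd : p' ∈ F.Dom := Part.dom_iff_mem.2 ⟨q', hq'⟩
        have h2 : preTuple p' m0 = preTuple p m0 := by
          rw [preTuple_eq_iff] at hp' ⊢
          intro j i hi
          exact hp' j i (by omega)
        have h3 := hm0 ⟨p', hd⟩ h2
        rw [← heq, ← h3]
        exact congrFun (Part.mem_unique hq' (Part.get_mem _)) k
    · rw [h]
      simpa using hm1

open Classical in
/-- The value of `F` as soon as it is known from the prefixes `u` of the arguments. -/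
noncomputable def wordApprox (F : (Fin n → Seq s) →. Word s) :
    ℕ → (Fin n → Word s) → Option (Word s)
  | 0, _ => none
  | m + 1, u =>
    match wordApprox F m fun j => (u j).take m with
    | some w => some w
    | none => if h : ∃ w, ∀ p, preTuple p (m + 1) = u → ∀ w' ∈ F p, w' = w then some h.choose
        else none

/-- A wrong value cannot be output at a point `p` of the domain, since `p` is itself among the
points that have to agree on the value. -/
theorem WordFunContinuous.approxWord {F : (Fin n → Seq s) →. Word s} (hF : WordFunContinuous F) :
    ApproxWord F (wordApprox F) := by
  have hmono : MonoWord (wordApprox F) := by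
    intro p m w h
    rw [wordApprox, take_preTuple p (Nat.le_succ m), h]
  refine ⟨hmono, fun p w hw => ?_⟩
  have hval : ∀ m w', wordApprox F m (preTuple p m) = some w' → w' = w := by
    intro m
    induction m with
    | zero => simp [wordApprox]
    | succ m ih =>
      intro w' h
      rw [wordApprox, take_preTuple p (Nat.le_succ m)] at h
      split at h
      · next w'' heq => exact ih w' (heq.trans h)
      · split at h
        · next hex =>
          rw [← Option.some.inj h]
          exact (hex.choose_spec p rfl w hw).symm
        · simp at h
  have hp : p ∈ F.Dom := Part.dom_iff_mem.2 ⟨w, hw⟩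
  obtain ⟨m0, hm0⟩ := exists_preTuple_of_isLocallyConstant hF ⟨p, hp⟩
  refine ⟨m0 + 1, ?_⟩
  obtain ⟨w', hw'⟩ : ∃ w', wordApprox F (m0 + 1) (preTuple p (m0 + 1)) = some w' := by
    rw [wordApprox, take_preTuple p (Nat.le_succ m0)]
    split
    · exact ⟨_, rfl⟩
    · rw [dif_pos]
      · exact ⟨_, rfl⟩
      · refine ⟨F.asSubtype ⟨p, hp⟩, fun p' hp' w' hw' => ?_⟩
        have hd : p' ∈ F.Dom := Part.dom_iff_mem.2 ⟨w', hw'⟩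
        have h2 : preTuple p' m0 = preTuple p m0 := by
          rw [preTuple_eq_iff] at hp' ⊢
          intro j i hi
          exact hp' j i (by omega)
        rw [← hm0 ⟨p', hd⟩ h2]
        exact Part.mem_unique hw' (Part.get_mem _)
  rw [hw', hval _ _ hw']

/-! ### Evaluation at words of different lengths -/

/-- The least of `m` and the lengths of the words `ws j`. -/
def level (m : ℕ) (ws : Fin n → Word s) : ℕ :=
  (List.ofFn ws).foldr (fun w k => min w.length k) m

theorem le_level_iff {k m : ℕ} {ws : Fin n → Word s} :
    k ≤ level m ws ↔ k ≤ m ∧ ∀ j, k ≤ (ws j).length := by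
  have : ∀ l : List (Word s), k ≤ l.foldr (fun w k => min w.length k) m ↔
      k ≤ m ∧ ∀ w ∈ l, k ≤ w.length := by
    intro l
    induction l with
    | nil => simp
    | cons a l ih =>
      simp only [List.foldr_cons, le_min_iff, ih, List.mem_cons, forall_eq_or_imp]
      tauto
  simp [level, this]

/-- Run the procedure `out` on words of possibly different lengths, with at most `m` stages. -/
def evalAt (out : ℕ → (Fin n → Word s) → α) (m : ℕ) (ws : Fin n → Word s) : α :=
  out (level m ws) fun j => (ws j).take (level m ws)

theorem evalAt_eq_of_isPre (out : ℕ → (Fin n → Word s) → α) (m : ℕ) {ws : Fin n → Word s}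
    {p : Fin n → Seq s} (h : ∀ j, IsPre (ws j) (p j)) :
    evalAt out m ws = out (level m ws) (preTuple p (level m ws)) := by
  unfold evalAt
  congr 1
  funext j
  exact (h j).take_eq ((le_level_iff.1 le_rfl).2 j)

/-- Padding the longer words with zeros gives one tuple of sequences along which both evaluations
run. Thus monotonicity along sequences becomes monotonicity on words of unequal lengths. -/
theorem exists_evalAt_eq (out : ℕ → (Fin n → Word s) → α) {m m' : ℕ} (hm : m ≤ m')
    {ws ws' : Fin n → Word s} (h : ∀ j, ws j <+: ws' j) :
    ∃ p k k', k ≤ k' ∧ evalAt out m ws = out k (preTuple p k) ∧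
      evalAt out m' ws' = out k' (preTuple p k') := by
  refine ⟨fun j => Word.toSeq (ws' j), level m ws, level m' ws', ?_, ?_, ?_⟩
  · have := le_level_iff.1 (le_refl (level m ws))
    exact le_level_iff.2 ⟨this.1.trans hm, fun j => (this.2 j).trans (h j).length_le⟩
  · exact evalAt_eq_of_isPre out m fun j => (Word.isPre_toSeq _).of_prefix (h j)
  · exact evalAt_eq_of_isPre out m' fun j => Word.isPre_toSeq _

/-- The bound `m` is what makes this hold for `n = 0`, where no word supplies a length. -/
theorem tendsto_level {ws : ℕ → Fin n → Word s} {q : Fin n → Seq s}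
    (h : ∀ j, Conv (fun m => ws m j) (q j)) :
    Tendsto (fun m => level m (ws m)) atTop atTop := by
  refine tendsto_atTop.2 fun k => ?_
  simp only [le_level_iff]
  exact (eventually_ge_atTop k).and
    (eventually_all.2 fun j => (h j).2.eventually (eventually_ge_atTop k))

theorem eventually_evalAt_eq (out : ℕ → (Fin n → Word s) → α) {ws : ℕ → Fin n → Word s}
    {q : Fin n → Seq s} (h : ∀ j, Conv (fun m => ws m j) (q j)) :
    ∀ᶠ m in atTop,
      evalAt out m (ws m) = out (level m (ws m)) (preTuple q (level m (ws m))) := by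
  filter_upwards [eventually_all.2 fun j => (h j).1] with m hm
  exact evalAt_eq_of_isPre out m hm

/-- The argument words need not grow monotonically in `m`: eventually they are prefixes of the
names, and then `out` runs on the names themselves at a level tending to infinity. -/
theorem ApproxSeq.conv_evalAt {F : (Fin n → Seq s) →. Seq s}
    {out : ℕ → (Fin n → Word s) → Word s} (hF : ApproxSeq F out) {ws : ℕ → Fin n → Word s}
    {p : Fin n → Seq s} (h : ∀ j, Conv (fun m => ws m j) (p j)) {q : Seq s} (hq : q ∈ F p) :
    Conv (fun m => evalAt out m (ws m)) q := by
  have h1 := hF.conv hq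
  have h2 := tendsto_level h
  refine Conv.congr (w := fun m => out (level m (ws m)) (preTuple p (level m (ws m))))
    ⟨h2.eventually h1.1, h1.2.comp h2⟩ ?_
  filter_upwards [eventually_evalAt_eq out h] with m hm
  exact hm.symm

theorem ApproxWord.eventually_evalAt {F : (Fin n → Seq s) →. Word s}
    {out : ℕ → (Fin n → Word s) → Option (Word s)} (hF : ApproxWord F out)
    {ws : ℕ → Fin n → Word s} {p : Fin n → Seq s} (h : ∀ j, Conv (fun m => ws m j) (p j))
    {w : Word s} (hw : w ∈ F p) :
    ∀ᶠ m in atTop, evalAt out m (ws m) = some w := by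
  obtain ⟨k, hk⟩ := hF.2 p w hw
  filter_upwards [eventually_evalAt_eq out h,
    (tendsto_level h).eventually (eventually_ge_atTop k)] with m h1 h2
  rw [h1]
  exact hF.1.of_le p h2 hk

end Approx

/-! ### Machines on words -/

section WordMachine

/-- The statements of a machine that simulates a generalized Turing machine on finite prefixes of
names. -/
inductive Instr (s L : ℕ) (Γ Λ : Type) : Type
  | right (i : Fin (L + 1)) (l : Λ)
  | left (i : Fin (L + 1)) (l : Λ)
  | write (i : Fin (L + 1)) (a : Γ) (l : Λ)
  | ifSymbol (i : Fin (L + 1)) (a : Γ) (l l' : Λ)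
  | assign (i : Fin (L + 1)) {n : ℕ} (src : Fin n → Fin (L + 1))
      (out : ℕ → (Fin n → Word s) → Word s) (l : Λ)
  | test {n : ℕ} (src : Fin n → Fin (L + 1))
      (out : ℕ → (Fin n → Word s) → Option (Word s)) (l l' : Λ)
  /-- Ask the oracle about the content of tape `i₁`, and write the answer on tape `i`. -/
  | call (i₁ i : Fin (L + 1)) (l : Λ)
  | halt

/-- The positions of the heads (a pair `(a, b)` stands for the position `a - b`) and the written
cells, last written first. -/
abbrev Tapes (s L : ℕ) (Γ : Type) :=
  (Fin (L + 1) → ℕ × ℕ) × List ((Fin (L + 1) × ℕ × ℕ) × (Word s ⊕ Γ))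

/-- A configuration: a label and the tapes. -/
abbrev WConfig (s L : ℕ) (Γ Λ : Type) := Λ × Tapes s L Γ

variable {s L : ℕ} {Γ Λ : Type}

/-! ### Tapes of words, ordered by extension of the cell contents -/

namespace Tapes

/-- The content of cell `z` of tape `i`, where `b` is the blank. -/
def lookup (b : Γ) (T : Tapes s L Γ) (i : Fin (L + 1)) (z : ℕ × ℕ) : Word s ⊕ Γ :=
  -- The fold gives priority to the latest entry; `a - b = a' - b'` is tested as `a + b' = a' + b`.
  T.2.foldr (fun e x => if e.1.1 = i ∧ e.1.2.1 + z.2 = z.1 + e.1.2.2 then e.2 else x) (Sum.inr b)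

/-- The content of the cell scanned on tape `i`. -/
def scan (b : Γ) (T : Tapes s L Γ) (i : Fin (L + 1)) : Word s ⊕ Γ := T.lookup b i (T.1 i)

/-- The word scanned on tape `i`. -/
def word (b : Γ) (T : Tapes s L Γ) (i : Fin (L + 1)) : Word s :=
  Sum.elim (fun w => w) (fun _ => []) (T.scan b i)

/-- Apply `d` to the position of head `i`. -/
def move (T : Tapes s L Γ) (i : Fin (L + 1)) (d : ℕ × ℕ → ℕ × ℕ) : Tapes s L Γ :=
  (fun j => if j = i then d (T.1 j) else T.1 j, T.2)

/-- Write `x` on the cell scanned on tape `i`. -/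
def put (T : Tapes s L Γ) (i : Fin (L + 1)) (x : Word s ⊕ Γ) : Tapes s L Γ :=
  (T.1, ((i, T.1 i), x) :: T.2)

theorem lookup_put (b : Γ) (T : Tapes s L Γ) (i : Fin (L + 1)) (x : Word s ⊕ Γ)
    (j : Fin (L + 1)) (z : ℕ × ℕ) :
    (T.put i x).lookup b j z =
      if i = j ∧ (T.1 i).1 + z.2 = z.1 + (T.1 i).2 then x else T.lookup b j z := rfl

/-- `T'` is obtained from `T` by extending the words in the cells. -/
def Le (b : Γ) (T T' : Tapes s L Γ) : Prop :=
  T.1 = T'.1 ∧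
    ∀ i z, Sum.LiftRel (· <+: ·) (· = ·) (T.lookup b i z) (T'.lookup b i z)

variable {b : Γ} {T T' : Tapes s L Γ}

theorem Le.refl (b : Γ) (T : Tapes s L Γ) : T.Le b T := by
  refine ⟨rfl, fun i z => ?_⟩
  cases T.lookup b i z with
  | inl w => exact Sum.LiftRel.inl List.prefix_rfl
  | inr a => exact Sum.LiftRel.inr rfl

theorem Le.scan (h : T.Le b T') (i : Fin (L + 1)) :
    Sum.LiftRel (· <+: ·) (· = ·) (T.scan b i) (T'.scan b i) := by
  have := h.2 i (T.1 i)
  unfold Tapes.scan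
  rwa [← congrFun h.1 i]

theorem Le.word (h : T.Le b T') (i : Fin (L + 1)) : T.word b i <+: T'.word b i := by
  have := h.scan i
  unfold Tapes.word
  revert this
  cases T.scan b i <;> cases T'.scan b i <;> simp

theorem Le.scan_eq_inr_iff (h : T.Le b T') (i : Fin (L + 1)) (a : Γ) :
    T.scan b i = Sum.inr a ↔ T'.scan b i = Sum.inr a := by
  have := h.scan i
  revert this
  cases T.scan b i <;> cases T'.scan b i <;> simp
  rintro rfl
  rfl

theorem Le.move (h : T.Le b T') (i : Fin (L + 1)) (d : ℕ × ℕ → ℕ × ℕ) :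
    (T.move i d).Le b (T'.move i d) := by
  refine ⟨?_, h.2⟩
  simp only [Tapes.move, h.1]

theorem Le.put (h : T.Le b T') (i : Fin (L + 1)) {x x' : Word s ⊕ Γ}
    (hx : Sum.LiftRel (· <+: ·) (· = ·) x x') : (T.put i x).Le b (T'.put i x') := by
  refine ⟨h.1, fun j z => ?_⟩
  rw [lookup_put, lookup_put, h.1]
  split
  · exact hx
  · exact h.2 j z

end Tapes

open Classical in
/-- Execute an instruction in stage `m` on tapes `T` under label `l₀`.  If the oracle has not
given an answer (`ρ = none`), the machine waits at an oracle call.  The result is `none` if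
the result of a test is not known in stage `m`. -/
noncomputable def exec (b : Γ) (m : ℕ) (ρ : Option (Word s)) (l₀ : Λ) (T : Tapes s L Γ) :
    Instr s L Γ Λ → Option (WConfig s L Γ Λ)
  | .right i l => some (l, T.move i fun z => (z.1 + 1, z.2))
  | .left i l => some (l, T.move i fun z => (z.1, z.2 + 1))
  | .write i a l => some (l, T.put i (Sum.inr a))
  | .ifSymbol i a l l' => some (if T.scan b i = Sum.inr a then l else l', T)
  | .assign i src out l => some (l, T.put i (Sum.inl (evalAt out m fun j => T.word b (src j))))
  | .test src out l l' =>
      (evalAt out m fun j => T.word b (src j)).map fun w => (if w = [0] then l else l', T)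
  | .call _ i l => some (ρ.elim (l₀, T) fun r => (l, T.put i (Sum.inl r)))
  | .halt => some (l₀, T)

/-- The procedures used by the instruction have monotone output. -/
def Instr.Mono : Instr s L Γ Λ → Prop
  | .assign _ _ out _ => MonoSeq out
  | .test _ out _ _ => MonoWord out
  | _ => True

/-- The procedures used by the instruction are computable. -/
def Instr.IsComputable : Instr s L Γ Λ → Prop
  | .assign _ _ out _ => Computable₂ out
  | .test _ out _ _ => Computable₂ out
  | _ => True

/-- The instruction is an oracle call. -/
def Instr.IsCall : Instr s L Γ Λ → Prop
  | .call _ _ _ => True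
  | _ => False

/-- The order on answers of the oracle. -/
def OracleLe (ρ ρ' : Option (Word s)) : Prop := Option.Rel (· <+: ·) ρ ρ'

/-- Control flow depends only on work symbols and on decided tests, which longer words do not alter.
`OracleLe` does not relate `none` to `some`: a machine waiting at a call and one that passes it have
different labels. -/
theorem exec_mono {b : Γ} {m m' : ℕ} (hm : m ≤ m') {ρ ρ' : Option (Word s)}
    (hρ : OracleLe ρ ρ') (l₀ : Λ) {T T' : Tapes s L Γ} (hT : T.Le b T') {I : Instr s L Γ Λ}
    (hI : I.Mono) {C : WConfig s L Γ Λ} (hC : exec b m ρ l₀ T I = some C) :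
    ∃ C', exec b m' ρ' l₀ T' I = some C' ∧ C.1 = C'.1 ∧ C.2.Le b C'.2 := by
  cases I with
  | right i l =>
    obtain rfl := Option.some.inj hC
    exact ⟨_, rfl, rfl, hT.move i _⟩
  | left i l =>
    obtain rfl := Option.some.inj hC
    exact ⟨_, rfl, rfl, hT.move i _⟩
  | write i a l =>
    obtain rfl := Option.some.inj hC
    exact ⟨_, rfl, rfl, hT.put i (Sum.LiftRel.inr rfl)⟩
  | ifSymbol i a l l' =>
    obtain rfl := Option.some.inj hC
    refine ⟨_, rfl, ?_, hT⟩
    have := hT.scan_eq_inr_iff i a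
    by_cases h : T.scan b i = Sum.inr a
    · simp only [if_pos h, if_pos (this.1 h)]
    · simp only [if_neg h, if_neg fun h' => h (this.2 h')]
  | assign i src out l =>
    obtain rfl := Option.some.inj hC
    refine ⟨_, rfl, rfl, hT.put i (Sum.LiftRel.inl ?_)⟩
    obtain ⟨p, k, k', hk, h1, h2⟩ := exists_evalAt_eq out hm fun j => hT.word (src j)
    rw [h1, h2]
    exact MonoSeq.prefix_of_le hI p hk
  | test src out l l' =>
    obtain ⟨p, k, k', hk, h1, h2⟩ := exists_evalAt_eq out hm fun j => hT.word (src j)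
    simp only [exec, h1, Option.map_eq_some_iff] at hC
    obtain ⟨w, hw, rfl⟩ := hC
    simp only [exec, h2, MonoWord.of_le hI p hk hw]
    exact ⟨_, rfl, rfl, hT⟩
  | call i₁ i l =>
    obtain rfl := Option.some.inj hC
    refine ⟨_, rfl, ?_⟩
    cases hρ with
    | none => exact ⟨rfl, hT⟩
    | some h => exact ⟨rfl, hT.put i (Sum.LiftRel.inl h)⟩
  | halt =>
    obtain rfl := Option.some.inj hC
    exact ⟨_, rfl, rfl, hT⟩

/-- Iterate the program for `n` steps in stage `m`. -/
noncomputable def run (b : Γ) (prog : Λ → Instr s L Γ Λ) (m : ℕ) (ρ : Option (Word s))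
    (n : ℕ) (C : WConfig s L Γ Λ) : Option (WConfig s L Γ Λ) :=
  n.rec (some C) fun _ o => o.bind fun D => exec b m ρ D.1 D.2 (prog D.1)

variable {b : Γ} {prog : Λ → Instr s L Γ Λ}

theorem run_succ (m : ℕ) (ρ : Option (Word s)) (n : ℕ) (C : WConfig s L Γ Λ) :
    run b prog m ρ (n + 1) C =
      (run b prog m ρ n C).bind fun D => exec b m ρ D.1 D.2 (prog D.1) := rfl

theorem run_add (m : ℕ) (ρ : Option (Word s)) (n k : ℕ) (C : WConfig s L Γ Λ) :
    run b prog m ρ (n + k) C = (run b prog m ρ n C).bind (run b prog m ρ k) := by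
  induction k with
  | zero =>
    change _ = (run b prog m ρ n C).bind some
    simp
  | succ k ih =>
    rw [← Nat.add_assoc, run_succ, ih, Option.bind_assoc]
    rfl

theorem run_mono (hprog : ∀ l, (prog l).Mono) {m m' : ℕ} (hm : m ≤ m') {ρ ρ' : Option (Word s)}
    (hρ : OracleLe ρ ρ') (n : ℕ) {C C' D : WConfig s L Γ Λ} (hl : C.1 = C'.1)
    (hT : C.2.Le b C'.2) (hD : run b prog m ρ n C = some D) :
    ∃ D', run b prog m' ρ' n C' = some D' ∧ D.1 = D'.1 ∧ D.2.Le b D'.2 := by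
  induction n generalizing D with
  | zero =>
    obtain rfl := Option.some.inj hD
    exact ⟨C', rfl, hl, hT⟩
  | succ n ih =>
    rw [run_succ, Option.bind_eq_some_iff] at hD
    obtain ⟨E, hE, hD⟩ := hD
    obtain ⟨E', hE', h1, h2⟩ := ih hE
    obtain ⟨D', hD', h3⟩ := exec_mono hm hρ E.1 h2 (hprog E.1) hD
    refine ⟨D', ?_, h3⟩
    rw [run_succ, hE', Option.bind_some, ← h1]
    exact hD'

/-- A configuration in which the machine waits. -/
def Waits (b : Γ) (prog : Λ → Instr s L Γ Λ) (ρ : Option (Word s)) (C : WConfig s L Γ Λ) : Prop :=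
  ∀ m, exec b m ρ C.1 C.2 (prog C.1) = some C

theorem run_of_waits {ρ : Option (Word s)} {C : WConfig s L Γ Λ} (h : Waits b prog ρ C)
    (m n : ℕ) : run b prog m ρ n C = some C := by
  induction n with
  | zero => rfl
  | succ n ih => rw [run_succ, ih, Option.bind_some, h m]

/-- Stage `m` always makes `m` steps, so a configuration reached earlier must survive the surplus
steps. -/
theorem run_eq_of_waits {m : ℕ} {ρ : Option (Word s)} {n n' : ℕ} (hn : n ≤ n')
    {C D : WConfig s L Γ Λ} (hD : run b prog m ρ n C = some D) (h : Waits b prog ρ D) :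
    run b prog m ρ n' C = some D := by
  obtain ⟨k, rfl⟩ := Nat.exists_eq_add_of_le hn
  rw [run_add, hD, Option.bind_some, run_of_waits h]

/-! ### The two reduction functions -/

/-- The initial configuration with `w` on the input tape. -/
def initConfig (start : Λ) (it : Fin (L + 1)) (w : Word s) : WConfig s L Γ Λ :=
  (start, fun _ => (0, 0), [((it, (0, 0)), Sum.inl w)])

theorem initConfig_le (b : Γ) (start : Λ) (it : Fin (L + 1)) {w w' : Word s} (h : w <+: w') :
    (initConfig start it w : WConfig s L Γ Λ).2.Le b
      (initConfig start it w' : WConfig s L Γ Λ).2 :=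
  (Tapes.Le.refl b ((fun _ => (0, 0), []) : Tapes s L Γ)).put it (Sum.LiftRel.inl h)

/-- The word read off at the end of the second phase of the simulation. -/
def resultOut (b : Γ) (prog : Λ → Instr s L Γ Λ) (C : WConfig s L Γ Λ) : Word s :=
  match prog C.1 with
  | .halt => Sum.elim (fun w => w) (fun _ => []) (C.2.lookup b 0 (0, 0))
  | _ => []

/-- The question to the oracle; if the machine has halted without asking one, this is `d`. -/
def questionOut (b : Γ) (prog : Λ → Instr s L Γ Λ) (d : Word s) (C : WConfig s L Γ Λ) : Word s :=
  match prog C.1 with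
  | .halt => d
  | .call i₁ _ _ => C.2.word b i₁
  | _ => []

theorem resultOut_mono {C C' : WConfig s L Γ Λ} (hl : C.1 = C'.1) (hT : C.2.Le b C'.2) :
    resultOut b prog C <+: resultOut b prog C' := by
  unfold resultOut
  rw [hl]
  split
  · have := hT.2 0 (0, 0)
    revert this
    cases C.2.lookup b 0 (0, 0) <;> cases C'.2.lookup b 0 (0, 0) <;> simp
  · exact List.prefix_rfl

theorem questionOut_mono {C C' : WConfig s L Γ Λ} (hl : C.1 = C'.1) (hT : C.2.Le b C'.2)
    {d d' : Word s} (hd : d <+: d') :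
    questionOut b prog d C <+: questionOut b prog d' C' := by
  unfold questionOut
  rw [hl]
  split
  · exact hd
  · exact hT.word _
  · exact List.prefix_rfl

/-- The procedure computing the result from the input and the answer of the oracle. -/
noncomputable def resultProc (b : Γ) (prog : Λ → Instr s L Γ Λ) (start : Λ) (it : Fin (L + 1))
    (m : ℕ) (u : Fin 2 → Word s) : Word s :=
  ((run b prog m (some (u 1)) m (initConfig start it (u 0))).map (resultOut b prog)).getD []

/-- The procedure computing the question to the oracle from the input, with prefixes of `p₀` as
default. -/
noncomputable def questionProc (b : Γ) (prog : Λ → Instr s L Γ Λ) (start : Λ) (it : Fin (L + 1))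
    (p₀ : Seq s) (m : ℕ) (u : Fin 1 → Word s) : Word s :=
  ((run b prog m none m (initConfig start it (u 0))).map (questionOut b prog (p₀.pre m))).getD []

theorem waits_of_halt {ρ : Option (Word s)} {C : WConfig s L Γ Λ} (h : prog C.1 = .halt) :
    Waits b prog ρ C := fun m => by rw [h]; rfl

theorem waits_of_call {C : WConfig s L Γ Λ} {i₁ i : Fin (L + 1)} {l : Λ}
    (h : prog C.1 = .call i₁ i l) : Waits b prog none C := fun m => by rw [h]; rfl

/-- A nonempty read-out occurs only where the machine waits, so the additional steps of the later
stage leave the configuration unchanged; undecided tests and unfinished runs give the empty word, a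
prefix of everything. -/
theorem prefix_of_run {ρ ρ' : Option (Word s)} (hρ : OracleLe ρ ρ') (hprog : ∀ l, (prog l).Mono)
    {m m' : ℕ} (hm : m ≤ m') {C C' : WConfig s L Γ Λ} (hl : C.1 = C'.1) (hT : C.2.Le b C'.2)
    {o o' : WConfig s L Γ Λ → Word s}
    (ho : ∀ D D' : WConfig s L Γ Λ, D.1 = D'.1 → D.2.Le b D'.2 → o D <+: o' D')
    (hw : ∀ D, o D ≠ [] → ∀ D' : WConfig s L Γ Λ, D.1 = D'.1 → Waits b prog ρ' D') :
    ((run b prog m ρ m C).map o).getD [] <+: ((run b prog m' ρ' m' C').map o').getD [] := by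
  cases hD : run b prog m ρ m C with
  | none => simp
  | some D =>
    obtain ⟨D', hD', h1, h2⟩ := run_mono hprog hm hρ m hl hT hD
    by_cases hne : o D = []
    · simp [hne]
    · rw [run_eq_of_waits hm hD' (hw D hne D' h1)]
      simpa using ho D D' h1 h2

theorem monoSeq_resultProc (hprog : ∀ l, (prog l).Mono) (start : Λ) (it : Fin (L + 1)) :
    MonoSeq (resultProc b prog start it) := by
  intro p m
  refine prefix_of_run (C := initConfig start it (preTuple p m 0))
    (C' := initConfig start it (preTuple p (m + 1) 0)) (Option.Rel.some (Seq.pre_prefix_pre _ (Nat.le_succ m))) hprog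
    (Nat.le_succ m) rfl (initConfig_le b start it (Seq.pre_prefix_pre _ (Nat.le_succ m)))
    (fun D D' h1 h2 => resultOut_mono h1 h2) fun D hD D' hl => waits_of_halt ?_
  rw [← hl]
  revert hD
  unfold resultOut
  split
  · exact fun _ => by assumption
  · simp

theorem monoSeq_questionProc (hprog : ∀ l, (prog l).Mono) (start : Λ) (it : Fin (L + 1))
    (p₀ : Seq s) : MonoSeq (questionProc b prog start it p₀) := by
  intro p m
  refine prefix_of_run (C := initConfig start it (preTuple p m 0))
    (C' := initConfig start it (preTuple p (m + 1) 0)) Option.Rel.none hprog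
    (Nat.le_succ m) rfl (initConfig_le b start it (Seq.pre_prefix_pre _ (Nat.le_succ m)))
    (fun D D' h1 h2 => questionOut_mono h1 h2 (Seq.pre_prefix_pre _ (Nat.le_succ m)))
    fun D hD D' hl => ?_
  revert hD
  unfold questionOut
  split
  · next h => exact fun _ => waits_of_halt (by rw [← hl, h])
  · next h => exact fun _ => waits_of_call (by rw [← hl, h])
  · simp

end WordMachine

/-! ### Computability of the simulation -/

section Computability

/-- A program is a finite table of instructions with unrelated computable procedures; a finite
cascade of equality tests on the label combines them into one computable function. -/
theorem computable_of_finite {α β σ : Type*} [Primcodable α] [Primcodable β] [Primcodable σ]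
    [Finite α] {f : α → β → σ} (h : ∀ a, Computable (f a)) : Computable₂ f := by
  classical
  have key : ∀ l : List α, ∃ g : α × β → Option σ, Computable g ∧
      ∀ x, x.1 ∈ l → g x = some (f x.1 x.2) := by
    intro l
    induction l with
    | nil => exact ⟨fun _ => none, Computable.const none, by simp⟩
    | cons a l ih =>
      obtain ⟨g, hg, hgl⟩ := ih
      refine ⟨fun x => bif decide (x.1 = a) then some (f a x.2) else g x,
        Computable.cond (Primrec.eq.decide.comp Primrec.fst (Primrec.const a)).to_comp
          (Computable.option_some.comp ((h a).comp Computable.snd)) hg, fun x hx => ?_⟩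
      by_cases hxa : x.1 = a
      · simp [← hxa]
      · simpa [hxa] using hgl x ((List.mem_cons.1 hx).resolve_left hxa)
  obtain ⟨l, -, hl⟩ := Finite.exists_univ_list α
  obtain ⟨g, hg, hgl⟩ := key l
  exact Computable.option_some_iff.1 (hg.of_eq fun x => hgl x (hl x.1))

variable {s L n : ℕ} {Γ Λ α σ : Type*} [Primcodable α] [Primcodable σ]

theorem primrec_level {mf : α → ℕ} {ws : α → Fin n → Word s} (hm : Primrec mf)
    (hws : ∀ j, Primrec fun a => ws a j) : Primrec fun a => level (mf a) (ws a) :=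
  Primrec.list_foldr (Primrec.list_ofFn hws) hm
    (Primrec.nat_min.comp (Primrec.list_length.comp (Primrec.fst.comp Primrec.snd))
      (Primrec.snd.comp Primrec.snd)).to₂

theorem computable_evalAt {out : ℕ → (Fin n → Word s) → σ} (hout : Computable₂ out)
    {mf : α → ℕ} {ws : α → Fin n → Word s} (hm : Primrec mf)
    (hws : ∀ j, Primrec fun a => ws a j) : Computable fun a => evalAt out (mf a) (ws a) := by
  have hl := primrec_level hm hws
  refine hout.comp hl.to_comp (Primrec.to_comp ?_)
  exact Primrec.fin_curry.2
    (Primrec.fin_curry₁.2 fun j => Primrec.list_take.comp hl (hws j)).swap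

end Computability

/-! ### Tape operations, runs and read-outs as computable functions -/

section Computability

variable {s L : ℕ} {Γ Λ : Type} [Primcodable Γ] [Primcodable Λ] {α : Type*} [Primcodable α]

theorem primrec_lookup (b : Γ) {T : α → Tapes s L Γ} (hT : Primrec T) (i : Fin (L + 1))
    {z : α → ℕ × ℕ} (hz : Primrec z) : Primrec fun a => (T a).lookup b i (z a) := by
  unfold Tapes.lookup
  refine Primrec.list_foldr (h := fun a x => if x.1.1.1 = i ∧
    x.1.1.2.1 + (z a).2 = (z a).1 + x.1.1.2.2 then x.1.2 else x.2)
    (Primrec.snd.comp hT) (Primrec.const _) ?_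
  have he : Primrec fun y : α × (((Fin (L + 1) × ℕ × ℕ) × (Word s ⊕ Γ)) × (Word s ⊕ Γ)) =>
    y.2.1 := Primrec.fst.comp Primrec.snd
  have hp := Primrec.fst.comp he
  have hz' := hz.comp (Primrec.fst (α := α)
    (β := ((Fin (L + 1) × ℕ × ℕ) × (Word s ⊕ Γ)) × (Word s ⊕ Γ)))
  refine Primrec.ite (PrimrecPred.and ?_ ?_) (Primrec.snd.comp he) (Primrec.snd.comp Primrec.snd)
  · exact Primrec.eq.comp (Primrec.fst.comp hp) (Primrec.const i)
  · exact Primrec.eq.comp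
      (Primrec.nat_add.comp (Primrec.fst.comp (Primrec.snd.comp hp)) (Primrec.snd.comp hz'))
      (Primrec.nat_add.comp (Primrec.fst.comp hz') (Primrec.snd.comp (Primrec.snd.comp hp)))

theorem primrec_head {T : α → Tapes s L Γ} (hT : Primrec T) (i : Fin (L + 1)) :
    Primrec fun a => (T a).1 i :=
  Primrec.fin_app.comp (Primrec.fst.comp hT) (Primrec.const i)

theorem primrec_scan (b : Γ) {T : α → Tapes s L Γ} (hT : Primrec T) (i : Fin (L + 1)) :
    Primrec fun a => (T a).scan b i :=
  primrec_lookup b hT i (primrec_head hT i)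

theorem primrec_wordOfCell {x : α → Word s ⊕ Γ} (hx : Primrec x) :
    Primrec fun a => Sum.elim (fun w => w) (fun _ => []) (x a) :=
  (Primrec.sumCasesOn hx (g := fun _ w => w) (h := fun _ _ => []) Primrec₂.right
    (Primrec₂.const [])).of_eq fun a => by cases x a <;> rfl

theorem primrec_word (b : Γ) {T : α → Tapes s L Γ} (hT : Primrec T) (i : Fin (L + 1)) :
    Primrec fun a => (T a).word b i :=
  primrec_wordOfCell (primrec_scan b hT i)

theorem primrec_move {T : α → Tapes s L Γ} (hT : Primrec T) (i : Fin (L + 1))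
    {d : ℕ × ℕ → ℕ × ℕ} (hd : Primrec d) : Primrec fun a => (T a).move i d := by
  refine Primrec.pair (Primrec.fin_curry.2 ?_) (Primrec.snd.comp hT)
  have h : Primrec fun x : α × Fin (L + 1) => (T x.1).1 x.2 :=
    Primrec.fin_app.comp (Primrec.fst.comp (hT.comp Primrec.fst)) Primrec.snd
  exact Primrec.ite (Primrec.eq.comp Primrec.snd (Primrec.const i)) (hd.comp h) h

theorem computable_put {T : α → Tapes s L Γ} (hT : Primrec T) (i : Fin (L + 1))
    {x : α → Word s ⊕ Γ} (hx : Computable x) : Computable fun a => (T a).put i (x a) :=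
  Computable.pair (Primrec.fst.comp hT).to_comp
    (Computable.list_cons.comp
      (Computable.pair ((Primrec.const i).pair (primrec_head hT i)).to_comp hx)
      (Primrec.snd.comp hT).to_comp)

theorem computable_exec (b : Γ) {I : Instr s L Γ Λ} (hI : I.IsComputable) :
    Computable fun x : (ℕ × Option (Word s)) × WConfig s L Γ Λ =>
      exec b x.1.1 x.1.2 x.2.1 x.2.2 I := by
  classical
  have hm : Primrec fun x : (ℕ × Option (Word s)) × WConfig s L Γ Λ => x.1.1 :=
    Primrec.fst.comp Primrec.fst
  have hρ : Primrec fun x : (ℕ × Option (Word s)) × WConfig s L Γ Λ => x.1.2 :=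
    Primrec.snd.comp Primrec.fst
  have hl : Primrec fun x : (ℕ × Option (Word s)) × WConfig s L Γ Λ => x.2.1 :=
    Primrec.fst.comp Primrec.snd
  have hT : Primrec fun x : (ℕ × Option (Word s)) × WConfig s L Γ Λ => x.2.2 :=
    Primrec.snd.comp Primrec.snd
  cases I with
  | right i l =>
    refine Computable.option_some.comp ((Computable.const l).pair (primrec_move hT i ?_).to_comp)
    exact (Primrec.succ.comp Primrec.fst).pair Primrec.snd
  | left i l =>
    refine Computable.option_some.comp ((Computable.const l).pair (primrec_move hT i ?_).to_comp)
    exact Primrec.fst.pair (Primrec.succ.comp Primrec.snd)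
  | write i a l =>
    exact Computable.option_some.comp
      ((Computable.const l).pair (computable_put hT i (Computable.const _)))
  | ifSymbol i a l l' =>
    refine Computable.option_some.comp (Computable.pair (Primrec.to_comp ?_) hT.to_comp)
    exact Primrec.ite (Primrec.eq.comp (primrec_scan b hT i) (Primrec.const _))
      (Primrec.const l) (Primrec.const l')
  | assign i src out l =>
    exact Computable.option_some.comp ((Computable.const l).pair (computable_put hT i
      (Computable.sumInl.comp (computable_evalAt hI hm fun j => primrec_word b hT (src j)))))
  | test src out l l' =>
    refine Computable.option_map
      (computable_evalAt hI hm fun j => primrec_word b hT (src j)) (Primrec.to_comp ?_)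
    exact (Primrec.ite (Primrec.eq.comp Primrec.snd (Primrec.const _)) (Primrec.const l)
      (Primrec.const l')).pair (hT.comp Primrec.fst)
  | call i₁ i l =>
    refine Computable.option_some.comp ?_
    refine (Computable.option_casesOn hρ.to_comp (hl.pair hT).to_comp
      (g := fun x r => (l, x.2.2.put i (Sum.inl r))) ?_).of_eq fun x => ?_
    · exact (Computable.const l).pair (computable_put (hT.comp Primrec.fst) i
        (Computable.sumInl.comp Computable.snd))
    · cases x.1.2 <;> rfl
  | halt => exact Computable.option_some.comp (hl.pair hT).to_comp

variable {prog : Λ → Instr s L Γ Λ}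

theorem computable_step [Finite Λ] (b : Γ) (hprog : ∀ l, (prog l).IsComputable) :
    Computable₂ fun (x : ℕ × Option (Word s)) (D : WConfig s L Γ Λ) =>
      exec b x.1 x.2 D.1 D.2 (prog D.1) := by
  have h := computable_of_finite fun l => computable_exec b (hprog l)
  exact h.comp (Computable.fst.comp Computable.snd) Computable.id

theorem computable_run [Finite Λ] (b : Γ) (hprog : ∀ l, (prog l).IsComputable) {m n : α → ℕ}
    {ρ : α → Option (Word s)} {C : α → WConfig s L Γ Λ} (hm : Computable m) (hn : Computable n)
    (hρ : Computable ρ) (hC : Computable C) :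
    Computable fun a => run b prog (m a) (ρ a) (n a) (C a) := by
  have hx : Computable fun a => (m a, ρ a) := hm.pair hρ
  have hstep : Computable₂ fun (a : α) (y : ℕ × Option (WConfig s L Γ Λ)) =>
      y.2.bind fun D => exec b (m a) (ρ a) D.1 D.2 (prog D.1) :=
    Computable.option_bind (Computable.snd.comp Computable.snd)
      ((computable_step b hprog).comp (hx.comp (Computable.fst.comp Computable.fst))
        Computable.snd)
  exact Computable.nat_rec hn (Computable.option_some.comp hC) hstep

theorem computable_resultOut [Finite Λ] (b : Γ) : Computable (resultOut b prog) := by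
  have : Computable₂ fun (l : Λ) (T : Tapes s L Γ) => resultOut b prog (l, T) := by
    refine computable_of_finite fun l => ?_
    cases h : prog l
    case halt =>
      simp only [resultOut, h]
      exact (primrec_wordOfCell (primrec_lookup b Primrec.id 0 (Primrec.const _))).to_comp
    all_goals
      simp only [resultOut, h]
      exact Computable.const _
  exact this.comp Computable.fst Computable.snd

theorem computable_questionOut [Finite Λ] (b : Γ) :
    Computable₂ fun (d : Word s) (C : WConfig s L Γ Λ) => questionOut b prog d C := by
  have : Computable₂ fun (l : Λ) (x : Word s × Tapes s L Γ) =>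
      questionOut b prog x.1 (l, x.2) := by
    refine computable_of_finite fun l => ?_
    cases h : prog l
    case halt =>
      simp only [questionOut, h]
      exact Computable.fst
    case call i₁ i l' =>
      simp only [questionOut, h]
      exact (primrec_word b Primrec.snd i₁).to_comp
    all_goals
      simp only [questionOut, h]
      exact Computable.const _
  exact this.comp (Computable.fst.comp Computable.snd)
    (Computable.fst.pair (Computable.snd.comp Computable.snd))

theorem computable_initConfig (start : Λ) (it : Fin (L + 1)) :
    Computable fun w : Word s => (initConfig start it w : WConfig s L Γ Λ) :=
  (Computable.const start).pair ((Computable.const _).pair (Computable.list_cons.comp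
    ((Computable.const _).pair Computable.sumInl) (Computable.const [])))

theorem computable_pre {p : Seq s} (hp : Computable p) : Computable fun m => p.pre m := by
  refine (Computable.nat_rec (f := fun m : ℕ => m) (g := fun _ => ([] : Word s))
    (h := fun _ x => x.2 ++ [p x.1]) Computable.id (Computable.const []) ?_).of_eq fun m => ?_
  · exact Computable.list_append.comp (Computable.snd.comp Computable.snd)
      (Computable.list_cons.comp (hp.comp (Computable.fst.comp Computable.snd))
        (Computable.const []))
  · induction m with
    | zero => rfl
    | succ m ih =>
      rw [Seq.pre_succ, ← ih]

theorem computable_resultProc [Finite Λ] (b : Γ) (hprog : ∀ l, (prog l).IsComputable) (start : Λ)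
    (it : Fin (L + 1)) : Computable₂ (resultProc b prog start it) := by
  have hu : ∀ i, Computable fun x : ℕ × (Fin 2 → Word s) => x.2 i := fun i =>
    Computable.fin_app.comp Computable.snd (Computable.const i)
  refine Computable.option_getD (Computable.option_map (computable_run b hprog Computable.fst
    Computable.fst (Computable.option_some.comp (hu 1)) ((computable_initConfig start it).comp
      (hu 0))) ((computable_resultOut b).comp Computable.snd).to₂) (Computable.const [])

theorem computable_questionProc [Finite Λ] (b : Γ) (hprog : ∀ l, (prog l).IsComputable) (start : Λ)
    (it : Fin (L + 1)) {p₀ : Seq s} (hp₀ : Computable p₀) :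
    Computable₂ (questionProc b prog start it p₀) := by
  have hu : ∀ i, Computable fun x : ℕ × (Fin 1 → Word s) => x.2 i := fun i =>
    Computable.fin_app.comp Computable.snd (Computable.const i)
  refine Computable.option_getD (Computable.option_map (computable_run b hprog Computable.fst
    Computable.fst (Computable.const none) ((computable_initConfig start it).comp
      (hu 0))) ?_) (Computable.const [])
  exact (computable_questionOut b).comp
    ((computable_pre hp₀).comp (Computable.fst.comp Computable.fst)) Computable.snd

end Computability

/-! ### Simulation of a generalized Turing machine on names -/

section Simulation

variable {s L : ℕ}

/-- The instruction `I` simulates the statement, where the assignments that apply `g` are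
simulated by oracle calls. -/
inductive Implements {Z : Fin (L + 1) → MRSet.{u} s} {S₃ S₄ : MRSet.{u} s}
    (g : MultiFun S₃ S₄) {Γ Λ : Type} :
    Stmt s (fun i => (Z i).carrier) Γ Λ → Instr s L Γ Λ → Prop
  | right (i l) : Implements g (.right i l) (.right i l)
  | left (i l) : Implements g (.left i l) (.left i l)
  | write (i a l) : Implements g (.write i a l) (.write i a l)
  | ifSymbol (i a l l') : Implements g (.ifSymbol i a l l') (.ifSymbol i a l l')
  | assign (i) {n : ℕ} (src : Fin n → Fin (L + 1)) (c l) {F out} (hF : ApproxSeq F out)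
      (hr : (⟨_, fun j => Z (src j), Z i, c⟩ : MFun.{u} s).RealizedBy F)
      (hg : (⟨_, fun j => Z (src j), Z i, c⟩ : MFun.{u} s) ≠ unary g) :
      Implements g (.assign i src c l) (.assign i src out l)
  | test {n : ℕ} (src : Fin n → Fin (L + 1)) (t h l l') {F out} (hF : ApproxWord F out)
      (hr : TestRealizedBy (fun j => Z (src j)) t F) :
      Implements g (.test src t h l l') (.test src out l l')
  | call (i) {n : ℕ} (src : Fin n → Fin (L + 1)) (c l) (j : Fin n)
      (hg : (⟨_, fun j => Z (src j), Z i, c⟩ : MFun.{u} s) = unary g) :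
      Implements g (.assign i src c l) (.call (src j) i l)

theorem Implements.mono {Z : Fin (L + 1) → MRSet.{u} s} {S₃ S₄ : MRSet.{u} s}
    {g : MultiFun S₃ S₄} {Γ Λ : Type} {S : Stmt s (fun i => (Z i).carrier) Γ Λ}
    {I : Instr s L Γ Λ} (h : Implements g S I) : I.Mono := by
  cases h with
  | assign _ _ _ _ hF => exact hF.1
  | test _ _ _ _ _ hF => exact hF.1
  | _ => trivial

/-- The condition `≠ unary g` in the `assign` case makes the oracle calls exactly the labels
applying `g`, so that the bound on applications of `g` bounds the calls. -/
theorem Implements.isCall_iff {Z : Fin (L + 1) → MRSet.{u} s} {S₃ S₄ : MRSet.{u} s}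
    {g : MultiFun S₃ S₄} {Γ Λ : Type} {S : Stmt s (fun i => (Z i).carrier) Γ Λ}
    {I : Instr s L Γ Λ} (h : Implements g S I) : I.IsCall ↔ S.Applies g := by
  cases h with
  | assign _ _ _ _ _ _ hg => exact ⟨False.elim, hg⟩
  | call _ _ _ _ _ hg => exact ⟨fun _ => hg, fun _ => trivial⟩
  | _ => exact Iff.rfl

/-- A multi-function that is equal to `g` can be evaluated on names by a realizer of `g`. -/
theorem exists_mem_of_eq_unary {S₃ S₄ : MRSet.{u} s} {g : MultiFun S₃ S₄} {n : ℕ}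
    {A : Fin n → MRSet.{u} s} {B : MRSet.{u} s} {c : MultiFun (∀ j, A j) B}
    (e : (⟨n, A, B, c⟩ : MFun.{u} s) = unary g) {h : (Fin 1 → Seq s) →. Seq s}
    (hh : (unary g).RealizedBy h) (j : Fin n) {v : ∀ j, A j} (hv : (c v).Nonempty) {q : Seq s}
    (hq : v j ∈ (A j).rep q) : ∃ r ∈ h ![q], ∃ z ∈ c v, z ∈ B.rep r := by
  unfold unary at e
  cases e
  obtain rfl : j = 0 := Subsingleton.elim _ _
  obtain ⟨h1, h2⟩ := hh ![q] v (fun (j : Fin 1) => by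
    obtain rfl : j = 0 := Subsingleton.elim _ _
    exact hq) hv
  exact ⟨_, Part.get_mem h1, h2 _ (Part.get_mem h1)⟩

/-- The contents `x m` approximate, for `m → ∞`, a name of the content of a cell. -/
inductive CellTracks {Γ : Type} (S : MRSet.{u} s) (x : ℕ → Word s ⊕ Γ) : S.carrier ⊕ Γ → Prop
  | inl {z : S} {q : Seq s} {w : ℕ → Word s} (hz : z ∈ S.rep q) (hw : Conv w q)
      (hx : ∀ᶠ m in atTop, x m = Sum.inl (w m)) : CellTracks S x (Sum.inl z)
  | inr {a : Γ} (hx : ∀ᶠ m in atTop, x m = Sum.inr a) : CellTracks S x (Sum.inr a)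

theorem CellTracks.congr {Γ : Type} {S : MRSet.{u} s} {x x' : ℕ → Word s ⊕ Γ}
    {y : S.carrier ⊕ Γ} (h : CellTracks S x y) (e : ∀ᶠ m in atTop, x' m = x m) :
    CellTracks S x' y := by
  cases h with
  | inl hz hw hx => exact .inl hz hw (by filter_upwards [hx, e] with m h1 h2; rw [h2, h1])
  | inr hx => exact .inr (by filter_upwards [hx, e] with m h1 h2; rw [h2, h1])

theorem CellTracks.exists_conv {Γ : Type} {S : MRSet.{u} s} {x : ℕ → Word s ⊕ Γ}
    {z : S} (h : CellTracks S x (Sum.inl z)) :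
    ∃ q, z ∈ S.rep q ∧ Conv (fun m => Sum.elim (fun w => w) (fun _ => []) (x m)) q := by
  cases h with
  | inl hz hw hx =>
    refine ⟨_, hz, hw.congr ?_⟩
    filter_upwards [hx] with m hm
    rw [hm]
    rfl

theorem CellTracks.eventually_eq_inr {Γ : Type} {S : MRSet.{u} s} {x : ℕ → Word s ⊕ Γ}
    {a : Γ} (h : CellTracks S x (Sum.inr a)) : ∀ᶠ m in atTop, x m = Sum.inr a := by
  cases h with
  | inr hx => exact hx

theorem CellTracks.eventually_ne_inr {Γ : Type} {S : MRSet.{u} s} {x : ℕ → Word s ⊕ Γ}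
    {y : S.carrier ⊕ Γ} (h : CellTracks S x y) {a : Γ} (hy : y ≠ Sum.inr a) :
    ∀ᶠ m in atTop, x m ≠ Sum.inr a := by
  cases h with
  | inl hz hw hx => filter_upwards [hx] with m hm; simp [hm]
  | inr hx => filter_upwards [hx] with m hm; simpa [hm] using hy

variable {Z : Fin (L + 1) → MRSet.{u} s} {N : GTM s (fun i => (Z i).carrier)}

/-- The tapes `T m` approximate, for `m → ∞`, names of the contents of the cells in the
configuration `κ`. -/
def Tracks (T : ℕ → Tapes s L N.Γ) (κ : N.Config) : Prop :=
  (∃ hd : Fin (L + 1) → ℕ × ℕ, (∀ᶠ m in atTop, (T m).1 = hd) ∧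
    ∀ i, ((hd i).1 : ℤ) - (hd i).2 = κ.head i) ∧
  ∀ i (z : ℕ × ℕ), CellTracks (Z i) (fun m => (T m).lookup N.blank i z) (κ.tape i (z.1 - z.2))

variable {T : ℕ → Tapes s L N.Γ} {κ : N.Config}

theorem Tracks.scan (h : Tracks T κ) (i : Fin (L + 1)) :
    CellTracks (Z i) (fun m => (T m).scan N.blank i) (κ.scan i) := by
  obtain ⟨⟨hd, h1, h2⟩, h3⟩ := h
  have := h3 i (hd i)
  rw [h2] at this
  refine this.congr ?_
  filter_upwards [h1] with m hm
  simp only [Tapes.scan, hm]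

theorem Tracks.exists_conv_word (h : Tracks T κ) {i : Fin (L + 1)} {z : Z i}
    (hz : κ.scan i = Sum.inl z) :
    ∃ q, z ∈ (Z i).rep q ∧ Conv (fun m => (T m).word N.blank i) q := by
  have := h.scan i
  rw [hz] at this
  exact this.exists_conv

theorem Tracks.goto (h : Tracks T κ) (l : N.Label) : Tracks T (κ.goto l) := h

theorem Tracks.move (h : Tracks T κ) (i : Fin (L + 1)) {d : ℕ × ℕ → ℕ × ℕ} {e : ℤ}
    (hd : ∀ z, ((d z).1 : ℤ) - (d z).2 = z.1 - z.2 + e) :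
    Tracks (fun m => (T m).move i d) (κ.move i e) := by
  obtain ⟨⟨hd', h1, h2⟩, h3⟩ := h
  refine ⟨⟨fun j => if j = i then d (hd' j) else hd' j, ?_, fun j => ?_⟩, h3⟩
  · filter_upwards [h1] with m hm
    simp only [Tapes.move, hm]
  · by_cases hj : j = i
    · subst hj
      simp [GTM.Config.move, hd, h2]
    · simp [GTM.Config.move, hj, h2]

theorem Tracks.put (h : Tracks T κ) (i : Fin (L + 1)) {x : ℕ → Word s ⊕ N.Γ}
    {y : (Z i).carrier ⊕ N.Γ} (hxy : CellTracks (Z i) x y) :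
    Tracks (fun m => (T m).put i (x m)) (κ.put i y) := by
  obtain ⟨⟨hd, h1, h2⟩, h3⟩ := h
  refine ⟨⟨hd, h1, h2⟩, fun j z => ?_⟩
  by_cases hj : i = j
  · subst hj
    by_cases hz : (hd i).1 + z.2 = z.1 + (hd i).2
    · have hz' : (z.1 : ℤ) - z.2 = κ.head i := by
        rw [← h2]
        omega
      simp only [GTM.Config.put, hz', Function.update_self]
      refine hxy.congr ?_
      filter_upwards [h1] with m hm
      rw [Tapes.lookup_put, hm, if_pos ⟨rfl, hz⟩]
    · have hz' : (z.1 : ℤ) - z.2 ≠ κ.head i := by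
        rw [← h2]
        omega
      simp only [GTM.Config.put, Function.update_self, Function.update_of_ne hz']
      refine (h3 i z).congr ?_
      filter_upwards [h1] with m hm
      rw [Tapes.lookup_put, hm, if_neg fun h => hz h.2]
  · simp only [GTM.Config.put, Function.update_of_ne (Ne.symm hj)]
    refine (h3 j z).congr (Eventually.of_forall fun m => ?_)
    rw [Tapes.lookup_put, if_neg fun h => hj h.1]

variable {S₃ S₄ : MRSet.{u} s} {g : MultiFun S₃ S₄}

/-- The successor is not prescribed: `N` is nondeterministic, and the realizer decides which
admissible value is written. The oracle is irrelevant because the instruction is not a call. -/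
theorem exists_exec_of_tracks (hT : Tracks T κ) {S : Stmt s (fun i => (Z i).carrier) N.Γ N.Label}
    {I : Instr s L N.Γ N.Label} (hS : Implements g S I) (hI : ¬ I.IsCall)
    (hex : ∃ κ', GTM.Exec κ κ' S) :
    ∃ κ' T', GTM.Exec κ κ' S ∧ Tracks T' κ' ∧ ∀ ρ : ℕ → Option (Word s),
      ∀ᶠ m in atTop, exec N.blank m (ρ m) κ.label (T m) I = some (κ'.label, T' m) := by
  obtain ⟨κ₀, hκ₀⟩ := hex
  cases hS with
  | right i l =>
    exact ⟨_, _, rfl, (hT.move i (d := fun z => (z.1 + 1, z.2)) (e := 1)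
      fun z => by push_cast; ring).goto l, fun ρ => Eventually.of_forall fun m => rfl⟩
  | left i l =>
    exact ⟨_, _, rfl, (hT.move i (d := fun z => (z.1, z.2 + 1)) (e := -1)
      fun z => by push_cast; ring).goto l, fun ρ => Eventually.of_forall fun m => rfl⟩
  | write i a l =>
    exact ⟨_, _, rfl, (hT.put i (.inr (Eventually.of_forall fun _ => rfl))).goto l,
      fun ρ => Eventually.of_forall fun m => rfl⟩
  | ifSymbol i a l l' =>
    have hs := hT.scan i
    by_cases h : κ.scan i = Sum.inr a
    · rw [h] at hs
      refine ⟨κ.goto l, T, Or.inl ⟨h, rfl⟩, hT.goto l, fun ρ => ?_⟩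
      filter_upwards [hs.eventually_eq_inr] with m hm
      simp only [exec, if_pos hm, GTM.Config.goto]
    · refine ⟨κ.goto l', T, Or.inr ⟨h, rfl⟩, hT.goto l', fun ρ => ?_⟩
      filter_upwards [hs.eventually_ne_inr h] with m hm
      simp only [exec, if_neg hm, GTM.Config.goto]
  | assign i src c l hF hr hg =>
    obtain ⟨v, hv, x, hx, -⟩ := hκ₀
    choose q hq hw using fun j => hT.exists_conv_word (hv j)
    -- The given successor only shows that `v` is in the domain of `c`; its value `x` is discarded
    -- in favour of one named by the realizer's output.
    obtain ⟨hd, hq'⟩ := hr q v hq ⟨x, hx⟩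
    obtain ⟨z, hz, hz'⟩ := hq' _ (Part.get_mem hd)
    exact ⟨_, _, ⟨v, hv, z, hz, rfl⟩, (hT.put i (.inl hz' (hF.conv_evalAt hw (Part.get_mem hd))
      (Eventually.of_forall fun _ => rfl))).goto l, fun ρ => Eventually.of_forall fun m => rfl⟩
  | test src t h l l' hF hr =>
    obtain ⟨v, hv, hκ₀⟩ := hκ₀
    choose q hq hw using fun j => hT.exists_conv_word (hv j)
    rcases hκ₀ with ⟨ht, -⟩ | ⟨ht, -⟩
    · refine ⟨κ.goto l, T, ⟨v, hv, Or.inl ⟨ht, rfl⟩⟩, hT.goto l, fun ρ => ?_⟩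
      filter_upwards [hF.eventually_evalAt hw (hr q v hq _ ht)] with m hm
      simp [exec, hm, GTM.Config.goto]
    · refine ⟨κ.goto l', T, ⟨v, hv, Or.inr ⟨ht, rfl⟩⟩, hT.goto l', fun ρ => ?_⟩
      filter_upwards [hF.eventually_evalAt hw (hr q v hq _ ht)] with m hm
      simp [exec, hm, GTM.Config.goto]
  | call i src c l j hg => exact absurd trivial hI

variable {prog : N.Label → Instr s L N.Γ N.Label}

/-- The simulation reaches an oracle call or the final label. -/
theorem exists_run_of_tracks (hprog : ∀ l h, Implements g (N.stm l h) (prog l))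
    (hacc : Acc (fun κ' κ : N.Config => GTM.Step κ κ') κ)
    (hstep : ∀ κ', Relation.ReflTransGen GTM.Step κ κ' → κ'.label ≠ N.final →
      ∃ κ'', GTM.Step κ' κ'') (hT : Tracks T κ) :
    ∃ κ' T' n, Relation.ReflTransGen
        (fun a b : N.Config => GTM.Step a b ∧ ¬ (prog a.label).IsCall) κ κ' ∧
      Tracks T' κ' ∧ (κ'.label = N.final ∨ (prog κ'.label).IsCall) ∧
      ∀ ρ : ℕ → Option (Word s), ∀ᶠ m in atTop,
        run N.blank prog m (ρ m) n (κ.label, T m) = some (κ'.label, T' m) := by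
  -- Without infinite computations, well-founded induction along `Step` reaches the end of the
  -- phase. The witnesses are fixed before `ρ`, so the same run serves `H` (no oracle) and `G` (with
  -- an answer).
  induction hacc generalizing T with
  | intro κ _ ih =>
    by_cases hend : κ.label = N.final ∨ (prog κ.label).IsCall
    · exact ⟨κ, T, 0, .refl, hT, hend, fun ρ => Eventually.of_forall fun m => rfl⟩
    · rw [not_or] at hend
      obtain ⟨κ₀, h0, h1⟩ := hstep κ .refl hend.1
      obtain ⟨κ₁, T₁, hex, hT₁, hrun₁⟩ :=
        exists_exec_of_tracks hT (hprog κ.label h0) hend.2 ⟨κ₀, h1⟩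
      have hs : GTM.Step κ κ₁ := ⟨h0, hex⟩
      obtain ⟨κ', T', n, h2, h3, h4, h5⟩ :=
        ih κ₁ hs (fun κ' h => hstep κ' (h.head hs)) hT₁
      refine ⟨κ', T', 1 + n, h2.head ⟨hs, hend.2⟩, h3, h4, fun ρ => ?_⟩
      filter_upwards [hrun₁ ρ, h5 ρ] with m hm1 hm2
      rw [run_add, run_succ]
      change (Option.bind (Option.bind (some (κ.label, T m)) _) _) = _
      rw [Option.bind_some, hm1, Option.bind_some, hm2]

end Simulation

/-! ### Computations and paths -/

section Chains

theorem exists_chain_of_reflTransGen {α : Type*} {r : α → α → Prop} {a b : α}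
    (h : Relation.ReflTransGen r a b) :
    ∃ (c : ℕ → α) (n : ℕ), c 0 = a ∧ c n = b ∧ ∀ i < n, r (c i) (c (i + 1)) := by
  induction h using Relation.ReflTransGen.head_induction_on with
  | refl => exact ⟨fun _ => b, 0, rfl, rfl, by simp⟩
  | head hac _ ih =>
    rename_i a c _
    obtain ⟨d, n, h1, h2, h3⟩ := ih
    refine ⟨fun i => i.casesOn a d, n + 1, rfl, h2, fun i hi => ?_⟩
    cases i with
    | zero =>
      change r a (d 0)
      rwa [h1]
    | succ i => exact h3 i (by omega)

variable {s L : ℕ} {X : Fin (L + 1) → Type u} {N : GTM s X}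

theorem GTM.Step.edge {κ κ' : N.Config} (h : GTM.Step κ κ') : N.Edge κ.label κ'.label := by
  obtain ⟨h0, h⟩ := h
  refine ⟨h0, ?_⟩
  revert h
  cases N.stm κ.label h0 with
  | right i l => rintro rfl; exact rfl
  | left i l => rintro rfl; exact rfl
  | write i a l => rintro rfl; exact rfl
  | ifSymbol i a l l' =>
    rintro (⟨-, rfl⟩ | ⟨-, rfl⟩)
    · exact Or.inl rfl
    · exact Or.inr rfl
  | assign i src c l => rintro ⟨v, -, x, -, rfl⟩; exact rfl
  | test src t h l l' =>
    rintro ⟨v, -, ⟨-, rfl⟩ | ⟨-, rfl⟩⟩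
    · exact Or.inl rfl
    · exact Or.inr rfl

theorem GTM.acc_of_not_infComputation {κ : N.Config}
    (h : ¬ ∃ c, GTM.InfComputation κ c) : Acc (fun κ' κ : N.Config => GTM.Step κ κ') κ := by
  by_contra hacc
  obtain ⟨c, h1, h2⟩ := not_acc_iff_exists_descending_chain.1 hacc
  exact h ⟨c, h1, h2⟩

theorem GTM.acc_of_reflTransGen {κ κ' : N.Config}
    (hacc : Acc (fun κ' κ : N.Config => GTM.Step κ κ') κ)
    (h : Relation.ReflTransGen GTM.Step κ κ') :
    Acc (fun κ' κ : N.Config => GTM.Step κ κ') κ' := by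
  induction h with
  | refl => exact hacc
  | tail _ hs ih => exact ih.inv hs

theorem GTM.exists_finComputation {κ κ' : N.Config}
    (h : Relation.ReflTransGen GTM.Step κ κ') :
    ∃ c n, GTM.FinComputation κ c n ∧ c n = κ' := by
  obtain ⟨c, n, h1, h2, h3⟩ := exists_chain_of_reflTransGen h
  exact ⟨c, n, ⟨h1, h3⟩, h2⟩

theorem GTM.edge_chain_of_reflTransGen {κ κ' : N.Config}
    (h : Relation.ReflTransGen GTM.Step κ κ') :
    Relation.ReflTransGen N.Edge κ.label κ'.label :=
  h.lift GTM.Config.label fun _ _ => GTM.Step.edge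

/-- After an application of `g` there is no other one. -/
theorem GTM.AppliesAtMostOnce.not_labelApplies {Z : Fin (L + 1) → MRSet.{u} s}
    {N : GTM s (fun i => (Z i).carrier)} {S₃ S₄ : MRSet.{u} s} {g : MultiFun S₃ S₄}
    (h : N.AppliesAtMostOnce g) {a b c : N.Label} (h1 : Relation.ReflTransGen N.Edge N.start a)
    (ha : N.LabelApplies g a) (hab : N.Edge a b) (h2 : Relation.ReflTransGen N.Edge b c) :
    ¬ N.LabelApplies g c := by
  intro hc
  obtain ⟨π, n, hπ0, hπn, hπ⟩ := exists_chain_of_reflTransGen h1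
  obtain ⟨π', n', hπ0', hπn', hπ'⟩ := exists_chain_of_reflTransGen h2
  -- The two paths are joined by the edge from `a` (index `n`) to `b` (index `n + 1`); `c` gets
  -- index `n + 1 + n'`.
  have hpath : N.IsPath (fun i => if i ≤ n then π i else π' (i - (n + 1))) (n + 1 + n') := by
    refine ⟨by simpa using hπ0, fun i hi => ?_⟩
    rcases lt_trichotomy i n with hlt | rfl | hgt
    · simpa [hlt.le, Nat.succ_le_of_lt hlt] using hπ i hlt
    · simpa [hπn, hπ0'] using hab
    · have e : i + 1 - (n + 1) = i - (n + 1) + 1 := by omega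
      simp only [if_neg (not_le.2 hgt), if_neg (show ¬ i + 1 ≤ n by omega), e]
      exact hπ' _ (by omega)
  have := h _ _ hpath n (by omega) (n + 1 + n') le_rfl (by simpa [hπn] using ha)
    (by simpa [hπn', show ¬ n + 1 + n' ≤ n by omega] using hc)
  omega

end Chains

/-! ### The reduction -/

section Reduction

variable {s L : ℕ} {Z : Fin (L + 1) → MRSet.{u} s} {N : GTM s (fun i => (Z i).carrier)}
  {S₃ S₄ : MRSet.{u} s} {g : MultiFun S₃ S₄}

theorem tracks_init (hk : N.k = 1) {x : ∀ j : Fin N.k, Z (N.inputTape j)} {p : Seq s}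
    (hp : ∀ j, x j ∈ (Z (N.inputTape j)).rep p) :
    Tracks (fun m => (initConfig N.start (N.inputTape ⟨0, by omega⟩) (p.pre m) :
      WConfig s L N.Γ N.Label).2) (N.init x) := by
  refine ⟨⟨fun _ => (0, 0), Eventually.of_forall fun m => rfl, fun i => by simp [GTM.init]⟩,
    fun i z => ?_⟩
  have hlook : ∀ m, Tapes.lookup N.blank (initConfig N.start (N.inputTape ⟨0, by omega⟩) (p.pre m) :
      WConfig s L N.Γ N.Label).2 i z =
      if N.inputTape ⟨0, by omega⟩ = i ∧ 0 + z.2 = z.1 + 0 then Sum.inl (p.pre m)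
        else Sum.inr N.blank := fun m => rfl
  simp only [hlook]
  cases i using Fin.cases with
  | zero =>
    refine .inr (Eventually.of_forall fun m => if_neg fun h => ?_)
    exact absurd h.1 (Fin.succ_ne_zero _)
  | succ j =>
    by_cases hj : (z.1 : ℤ) - z.2 = 0 ∧ j.val < N.k
    · obtain ⟨j, hjL⟩ := j
      obtain rfl : j = 0 := by
        have : j < N.k := hj.2
        omega
      have e : (N.init x).tape (Fin.succ ⟨0, hjL⟩) (z.1 - z.2) = Sum.inl (x ⟨0, hj.2⟩) := dif_pos hj
      rw [e]
      refine .inl (hp ⟨0, hj.2⟩) (conv_pre p) (Eventually.of_forall fun m => if_pos ⟨rfl, ?_⟩)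
      omega
    · have e : (N.init x).tape j.succ (z.1 - z.2) = Sum.inr N.blank := dif_neg hj
      rw [e]
      refine .inr (Eventually.of_forall fun m => if_neg fun h => hj ⟨by omega, ?_⟩)
      have h1 := congrArg Fin.val (Fin.succ_injective _ h.1)
      change 0 = j.val at h1
      omega

/-- A dead end with a nonfinal label would finish a maximal computation that is not accepting. -/
theorem exists_step_of_mem_dom {x : ∀ j : Fin N.k, Z (N.inputTape j)} (hx : x ∈ N.compute.dom)
    {κ : N.Config} (h : Relation.ReflTransGen GTM.Step (N.init x) κ) (hκ : κ.label ≠ N.final) :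
    ∃ κ', GTM.Step κ κ' := by
  obtain ⟨x₀, ⟨-, hmax⟩, -⟩ := hx
  by_contra! hno
  obtain ⟨c, n, hc, rfl⟩ := GTM.exists_finComputation h
  obtain ⟨y, hy, -⟩ := hmax c n hc hno
  exact hκ hy

theorem exists_result_of_mem_dom {x : ∀ j : Fin N.k, Z (N.inputTape j)} (hx : x ∈ N.compute.dom)
    {κ : N.Config} (h : Relation.ReflTransGen GTM.Step (N.init x) κ) (hκ : κ.label = N.final) :
    ∃ y ∈ N.compute x, κ.tape 0 0 = Sum.inl y := by
  obtain ⟨x₀, ⟨hinf, hmax⟩, -⟩ := hx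
  obtain ⟨c, n, hc, rfl⟩ := GTM.exists_finComputation h
  obtain ⟨y, hy⟩ := hmax c n hc fun κ' hs => hs.1 hκ
  exact ⟨y, ⟨⟨hinf, hmax⟩, c, n, hc, hy⟩, hy.2⟩

/-! ### Correctness of the two phases -/

variable {prog : N.Label → Instr s L N.Γ N.Label}

theorem conv_resultProc (hhalt : prog N.final = .halt) {it : Fin (L + 1)}
    {x : ∀ j : Fin N.k, Z (N.inputTape j)} (hx : x ∈ N.compute.dom) {κ : N.Config}
    (h : Relation.ReflTransGen GTM.Step (N.init x) κ) (hκ : κ.label = N.final)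
    {T : ℕ → Tapes s L N.Γ} (hT : Tracks T κ) {p r : Seq s} {n : ℕ}
    (hrun : ∀ᶠ m in atTop, run N.blank prog m (some (r.pre m)) n
      (initConfig N.start it (p.pre m)) = some (κ.label, T m)) :
    ∃ q ∈ fromOut (resultProc N.blank prog N.start it) ![p, r],
      ∃ y ∈ N.compute x, y ∈ (Z 0).rep q := by
  obtain ⟨y, hy, hy0⟩ := exists_result_of_mem_dom hx h hκ
  have hcell := hT.2 0 (0, 0)
  simp only [Nat.cast_zero, sub_self, hy0] at hcell
  obtain ⟨q, hq, hconv⟩ := hcell.exists_conv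
  refine ⟨q, mem_fromOut.2 (hconv.congr ?_), y, hy, hq⟩
  filter_upwards [hrun, eventually_ge_atTop n] with m hm hn
  have hw : prog κ.label = .halt := by rw [hκ, hhalt]
  have hm' := run_eq_of_waits hn hm (waits_of_halt hw)
  have hu0 : preTuple ![p, r] m 0 = p.pre m := rfl
  have hu1 : preTuple ![p, r] m 1 = r.pre m := rfl
  rw [resultProc, hu0, hu1, hm', Option.map_some, Option.getD_some, resultOut]
  simp only [hw]

/-- The first run stops at the final label or at a call. In the former case the answer is irrelevant
and only the definedness of `h` at the question matters; in the latter the answer is written and a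
second run, which can meet no further call, reaches the final label. -/
theorem exists_mem_reductionFun (hprog : ∀ l h, Implements g (N.stm l h) (prog l))
    (hhalt : prog N.final = .halt) (honce : N.AppliesAtMostOnce g) (hk : N.k = 1) {p₀ : Seq s}
    {D : Set (∀ j : Fin N.k, Z (N.inputTape j))}
    (hp₀ : (∃ y ∈ g.dom, y ∈ S₃.rep p₀) ∨ N.AlwaysApplies g D)
    {x : ∀ j : Fin N.k, Z (N.inputTape j)} (hx : x ∈ N.compute.dom) (hxD : x ∈ D) {p : Seq s}
    (hp : ∀ j, x j ∈ (Z (N.inputTape j)).rep p) {h : (Fin 1 → Seq s) →. Seq s}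
    (hh : (unary g).RealizedBy h) :
    ∃ q ∈ reductionFun
        (fromOut (resultProc N.blank prog N.start (N.inputTape ⟨0, by omega⟩)))
        (fromOut (questionProc N.blank prog N.start (N.inputTape ⟨0, by omega⟩) p₀)) h ![p],
      ∃ y ∈ N.compute x, y ∈ (Z 0).rep q := by
  have happ : ∀ l, (prog l).IsCall ↔ N.LabelApplies g l := by
    intro l
    by_cases hl : l = N.final
    · subst hl
      rw [hhalt]
      exact ⟨False.elim, fun h => absurd rfl h.1⟩
    · rw [(hprog l hl).isCall_iff]
      exact ⟨fun h => ⟨hl, h⟩, fun h => h.2⟩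
  have hinit := GTM.acc_of_not_infComputation hx.some_mem.1.1
  obtain ⟨κ₁, T₁, n₁, hκ₁, hT₁, hend, hrun₁⟩ := exists_run_of_tracks hprog hinit
    (fun κ' h => exists_step_of_mem_dom hx h) (tracks_init hk hp)
  have hreach₁ : Relation.ReflTransGen GTM.Step (N.init x) κ₁ :=
    hκ₁.lift id fun _ _ h => h.1
  have hmem : ∀ {q r y : _}, q ∈ fromOut (questionProc N.blank prog N.start _ p₀) ![p] →
      r ∈ h ![q] → y ∈ fromOut (resultProc N.blank prog N.start _) ![p, r] →
      y ∈ reductionFun (fromOut (resultProc N.blank prog N.start (N.inputTape ⟨0, by omega⟩)))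
        (fromOut (questionProc N.blank prog N.start (N.inputTape ⟨0, by omega⟩) p₀)) h ![p] :=
    fun h1 h2 h3 => Part.mem_bind h1 (Part.mem_bind h2 h3)
  have hu0 : ∀ m, preTuple ![p] m 0 = p.pre m := fun m => rfl
  by_cases hfin : κ₁.label = N.final
  · rcases hp₀ with ⟨y₀, hy₀, hy₀'⟩ | hall
    · have hw : prog κ₁.label = .halt := by rw [hfin, hhalt]
      have hq : p₀ ∈ fromOut (questionProc N.blank prog N.start
          (N.inputTape ⟨0, by omega⟩) p₀) ![p] := by
        refine mem_fromOut.2 ((conv_pre p₀).congr ?_)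
        filter_upwards [hrun₁ fun _ => none, eventually_ge_atTop n₁] with m hm hn
        have hm' := run_eq_of_waits hn hm (waits_of_halt hw)
        change run N.blank prog m none m (initConfig N.start _ (p.pre m)) = _ at hm'
        rw [questionProc, hu0, hm', Option.map_some, Option.getD_some, questionOut]
        simp only [hw]
      -- A realizer is guaranteed to be defined only on names of elements of `dom g`; here `p₀` is
      -- one.
      obtain ⟨hd, -⟩ := hh ![p₀] (fun _ => y₀) (fun (j : Fin 1) => by
        obtain rfl : j = 0 := Subsingleton.elim _ _
        exact hy₀') hy₀
      obtain ⟨q, hq', hres⟩ := conv_resultProc hhalt hx hreach₁ hfin hT₁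
        (hrun₁ fun m => some (((h ![p₀]).get hd).pre m))
      exact ⟨q, hmem hq (Part.get_mem hd) hq', hres⟩
    -- This accepting computation has no call before its end, and a final label applies nothing, so
    -- it contradicts `AlwaysApplies`.
    · obtain ⟨c, n, hc0, rfl, hc⟩ := exists_chain_of_reflTransGen hκ₁
      obtain ⟨y, -, hy⟩ := exists_result_of_mem_dom hx hreach₁ hfin
      obtain ⟨i, hi, hli⟩ := hall x hxD c n ⟨hc0, fun i hi => (hc i hi).1⟩ ⟨y, hfin, hy⟩
      rcases hi.lt_or_eq with hlt | rfl
      · exact absurd ((happ _).2 hli) (hc i hlt).2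
      · exact absurd hfin hli.1
  · have hcall := hend.resolve_left hfin
    obtain ⟨κ₀, h0, hex⟩ := exists_step_of_mem_dom hx hreach₁ hfin
    have himp := hprog κ₁.label h0
    generalize hS : N.stm κ₁.label h0 = S at himp hex
    generalize hI : prog κ₁.label = I at himp hcall
    cases himp with
    | call i src c l j hg =>
      obtain ⟨v, hv, z₀, hz₀, -⟩ := hex
      obtain ⟨q, hvq, hqw⟩ := hT₁.exists_conv_word (hv j)
      obtain ⟨r, hr, z, hz, hzr⟩ := exists_mem_of_eq_unary hg hh j ⟨z₀, hz₀⟩ hvq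
      have hq : q ∈ fromOut (questionProc N.blank prog N.start
          (N.inputTape ⟨0, by omega⟩) p₀) ![p] := by
        refine mem_fromOut.2 (hqw.congr ?_)
        filter_upwards [hrun₁ fun _ => none, eventually_ge_atTop n₁] with m hm hn
        have hm' := run_eq_of_waits hn hm (waits_of_call hI)
        change run N.blank prog m none m (initConfig N.start _ (p.pre m)) = _ at hm'
        rw [questionProc, hu0, hm', Option.map_some, Option.getD_some, questionOut]
        simp only [hI]
      -- The computation continues with the value `z` named by the answer `r`, not with `z₀`, which
      -- only witnessed the domain.
      have hstep : GTM.Step κ₁ ((κ₁.put i (Sum.inl z)).goto l) :=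
        ⟨h0, by rw [hS]; exact ⟨v, hv, z, hz, rfl⟩⟩
      have hT₂ : Tracks (fun m => (T₁ m).put i (Sum.inl (r.pre m)))
          ((κ₁.put i (Sum.inl z)).goto l) :=
        (hT₁.put i (.inl hzr (conv_pre r) (Eventually.of_forall fun _ => rfl))).goto l
      have hreach₂ := hreach₁.tail hstep
      obtain ⟨κ₃, T₃, n₃, hκ₃, hT₃, hend₃, hrun₃⟩ := exists_run_of_tracks hprog
        (GTM.acc_of_reflTransGen hinit hreach₂)
        (fun κ' h => exists_step_of_mem_dom hx (hreach₂.trans h)) hT₂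
      have hreach₂₃ : Relation.ReflTransGen GTM.Step _ κ₃ :=
        hκ₃.lift id fun _ _ h => h.1
      -- A second call would give a path in the graph that applies `g` twice.
      have hfin₃ : κ₃.label = N.final := by
        refine hend₃.resolve_right fun hc => ?_
        refine honce.not_labelApplies (GTM.edge_chain_of_reflTransGen hreach₁)
          ((happ _).1 ?_) hstep.edge (GTM.edge_chain_of_reflTransGen hreach₂₃) ((happ _).1 hc)
        rw [hI]
        trivial
      -- The middle `1` in `n₁ + 1 + n₃` is the call, passed by writing the prefix of `r`.
      obtain ⟨y, hy, hres⟩ := conv_resultProc hhalt (it := N.inputTape ⟨0, by omega⟩) (p := p)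
        (r := r) (n := n₁ + 1 + n₃) hx (hreach₂.trans hreach₂₃) hfin₃ hT₃ (by
          filter_upwards [hrun₁ fun m => some (r.pre m), hrun₃ fun m => some (r.pre m)]
            with m hm₁ hm₃
          change run N.blank prog m _ n₁ (initConfig N.start _ (p.pre m)) = _ at hm₁
          rw [run_add, run_succ, hm₁, Option.bind_some]
          change ((exec N.blank m (some (r.pre m)) κ₁.label (T₁ m) (prog κ₁.label)).bind _) = _
          rw [hI]
          exact hm₃)
      exact ⟨y, hmem hq hr hy, hres⟩
    | _ => exact hcall.elim

/-- Eliminating the equality of bundled multi-functions identifies the arity and the sets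
simultaneously, which avoids casts between dependent tuples. -/
theorem realizedBy_unary_of_eq {S₁ S₂ : MRSet.{u} s} {f : MultiFun S₁ S₂} {n : ℕ}
    {A : Fin n → MRSet.{u} s} {B : MRSet.{u} s} {c : MultiFun (∀ j, A j) B}
    (e : (⟨n, A, B, c⟩ : MFun.{u} s) = unary f) {F : (Fin 1 → Seq s) →. Seq s}
    (hF : ∀ (p : Seq s) (x : ∀ j, A j), (∀ j, x j ∈ (A j).rep p) → x ∈ c.dom →
      ∃ q ∈ F ![p], ∃ y ∈ c x, y ∈ B.rep q) : (unary f).RealizedBy F := by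
  unfold unary at e
  cases e
  intro (p : Fin 1 → Seq s) x hx hxd
  obtain ⟨q, hq, hy⟩ := hF (p 0) x (fun j => by
    obtain rfl : j = 0 := Subsingleton.elim _ _
    exact hx (0 : Fin 1)) hxd
  have hp : (![p 0] : Fin 1 → Seq s) = p := by
    funext j
    obtain rfl : j = 0 := Subsingleton.elim _ _
    rfl
  rw [hp] at hq
  refine ⟨Part.dom_iff_mem.2 ⟨q, hq⟩, fun q' hq' => ?_⟩
  rwa [Part.mem_unique hq' hq]

/-! ### Existence of the simulating program -/

theorem Stmt.AssignSat.imp {Γ Λ : Type} {P Q : MFun.{u} s → Prop} (h : ∀ c, P c → Q c)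
    {S : Stmt s (fun i => (Z i).carrier) Γ Λ} (hS : S.AssignSat P) : S.AssignSat Q := by
  cases S with
  | assign => exact h _ hS
  | _ => trivial

/-- The multi-function has a realizer that is approximated by a procedure, which is
computable if `E` holds. -/
def MFun.HasApprox (E : Prop) (c : MFun.{u} s) : Prop :=
  ∃ F out, ApproxSeq F out ∧ c.RealizedBy F ∧ (E → Computable₂ out)

/-- The test has a realizer that is approximated by a procedure, which is computable if `E`
holds. -/
def TestHasApprox (E : Prop) {n : ℕ} (S : Fin n → MRSet.{u} s) (t : (∀ j, S j) →. Word s) :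
    Prop :=
  ∃ F out, ApproxWord F out ∧ TestRealizedBy S t F ∧ (E → Computable₂ out)

theorem Stmt.TestSat.imp {Γ Λ : Type}
    {P Q : ∀ {n : ℕ} (S : Fin n → MRSet.{u} s), ((∀ j, S j) →. Word s) → Prop}
    (h : ∀ {n : ℕ} (S : Fin n → MRSet.{u} s) t, P S t → Q S t)
    {S : Stmt s (fun i => (Z i).carrier) Γ Λ} (hS : S.TestSat P) : S.TestSat Q := by
  cases S with
  | test => exact h _ _ hS
  | _ => trivial

theorem exists_implements {E : Prop} {Γ Λ : Type} {S : Stmt s (fun i => (Z i).carrier) Γ Λ}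
    (hA : S.AssignSat (MFun.HasApprox E) ∨ S.Applies g) (hT : S.TestSat (TestHasApprox E)) :
    ∃ I, Implements g S I ∧ (E → I.IsComputable) := by
  cases S with
  | right i l => exact ⟨_, .right i l, fun _ => trivial⟩
  | left i l => exact ⟨_, .left i l, fun _ => trivial⟩
  | write i a l => exact ⟨_, .write i a l, fun _ => trivial⟩
  | ifSymbol i a l l' => exact ⟨_, .ifSymbol i a l l', fun _ => trivial⟩
  | @assign i n src c l =>
    by_cases hg : (⟨_, fun j => Z (src j), Z i, c⟩ : MFun.{u} s) = unary g
    · have hn : n = 1 := congrArg MFun.arity hg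
      exact ⟨_, .call i src c l ⟨0, by omega⟩ hg, fun _ => trivial⟩
    · obtain ⟨F, out, hF, hr, hE⟩ := hA.resolve_right hg
      exact ⟨_, .assign i src c l hF hr hg, hE⟩
  | test src t h l l' =>
    obtain ⟨F, out, hF, hr, hE⟩ := hT
    exact ⟨_, .test src t h l l' hF hr, hE⟩

/-- The proposition `E` lets one construction serve both halves: it is `True` for computability and
`False` for continuity, where the procedures are arbitrary functions on words. -/
theorem exists_reduction (E : Prop) {S₁ S₂ : MRSet.{u} s} {f : MultiFun S₁ S₂}
    {f₀ : MultiFun (∀ j : Fin N.k, Z (N.inputTape j)) (Z 0)}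
    (hf₀ : (⟨N.k, fun j => Z (N.inputTape j), Z 0, f₀⟩ : MFun.{u} s) = unary f)
    (honce : N.AppliesAtMostOnce g) (hext : MultiFun.Extends N.compute f₀)
    (hA : ∀ l h, (N.stm l h).AssignSat (MFun.HasApprox E) ∨ (N.stm l h).Applies g)
    (hT : ∀ l h, (N.stm l h).TestSat (TestHasApprox E)) {p₀ : Seq s}
    (hp₀ : (∃ y ∈ g.dom, y ∈ S₃.rep p₀) ∨ N.AlwaysApplies g f₀.dom) :
    ∃ outG outH, ApproxSeq (fromOut outG) outG ∧ ApproxSeq (fromOut outH) outH ∧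
      IsReduction (fromOut outG) (fromOut outH) f g ∧
      (E → Computable p₀ → Computable₂ outG ∧ Computable₂ outH) := by
  have hex : ∀ l, ∃ I : Instr s L N.Γ N.Label, (∀ h : l ≠ N.final, Implements g (N.stm l h) I) ∧
      (l = N.final → I = .halt) ∧ (E → I.IsComputable) := by
    intro l
    by_cases hl : l = N.final
    · exact ⟨.halt, fun h => absurd hl h, fun _ => rfl, fun _ => trivial⟩
    · obtain ⟨I, hI, hE⟩ := exists_implements (hA l hl) (hT l hl)
      exact ⟨I, fun _ => hI, fun h => absurd h hl, hE⟩
  choose prog hprog hhalt hcomp using hex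
  have hk : N.k = 1 := congrArg MFun.arity hf₀
  have hmono : ∀ l, (prog l).Mono := by
    intro l
    by_cases hl : l = N.final
    · rw [hhalt l hl]
      trivial
    · exact (hprog l hl).mono
  refine ⟨resultProc N.blank prog N.start (N.inputTape ⟨0, by omega⟩),
    questionProc N.blank prog N.start (N.inputTape ⟨0, by omega⟩) p₀,
    approxSeq_fromOut (monoSeq_resultProc hmono _ _),
    approxSeq_fromOut (monoSeq_questionProc hmono _ _ _), fun h hh => ?_, fun hE hc => ?_⟩
  · refine realizedBy_unary_of_eq hf₀ fun p x hp hx => ?_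
    obtain ⟨q, hq, y, hy, hyq⟩ := exists_mem_reductionFun hprog (hhalt _ rfl) honce hk hp₀
      (hext.1 hx) hx hp hh
    exact ⟨q, hq, y, hext.2 x hx hy, hyq⟩
  · have := N.finite_label
    have := N.finite_Γ
    -- Labels and work symbols are coded through a numbering of these finite sets.
    let _ : Primcodable N.Label := Primcodable.ofEquiv _ (Finite.equivFin N.Label)
    let _ : Primcodable N.Γ := Primcodable.ofEquiv _ (Finite.equivFin N.Γ)
    exact ⟨computable_resultProc _ (fun l => hcomp l hE) _ _,
      computable_questionProc _ (fun l => hcomp l hE) _ _ hc⟩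

/-! ### From computable or continuous data to approximating procedures -/

theorem MFun.IsComputable.hasApprox {c : MFun.{u} s} (h : c.IsComputable) : c.HasApprox True := by
  obtain ⟨F, hF, hr⟩ := h
  obtain ⟨out, hc, ha⟩ := hF.exists_approx
  exact ⟨F, out, ha, hr, fun _ => hc⟩

theorem MFun.IsContinuous.hasApprox {c : MFun.{u} s} (h : c.IsContinuous) : c.HasApprox False := by
  obtain ⟨F, hF, hr⟩ := h
  exact ⟨F, _, hF.approxSeq, hr, False.elim⟩

theorem TestComputable.hasApprox {n : ℕ} {S : Fin n → MRSet.{u} s} {t : (∀ j, S j) →. Word s}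
    (h : TestComputable S t) : TestHasApprox True S t := by
  obtain ⟨F, hF, hr⟩ := h
  obtain ⟨out, hc, ha⟩ := hF.exists_approx
  exact ⟨F, out, ha, hr, fun _ => hc⟩

theorem TestContinuous.hasApprox {n : ℕ} {S : Fin n → MRSet.{u} s} {t : (∀ j, S j) →. Word s}
    (h : TestContinuous S t) : TestHasApprox False S t := by
  obtain ⟨F, hF, hr⟩ := h
  exact ⟨F, _, hF.approxWord, hr, False.elim⟩

/-- If `dom g` were empty, the nowhere defined function, which is continuous, would realize `g`. -/
theorem dom_nonempty_of_not_isContinuous (h : ¬ (unary g).IsContinuous) : g.dom.Nonempty := by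
  by_contra hemp
  refine h ⟨fun _ => Part.none, ?_, fun p y _ hy => absurd ⟨_, hy⟩ hemp⟩
  exact continuous_iff_continuousAt.2 fun x => absurd x.2 id

end Reduction

end GTMWeihrauch

theorem theoremt9 {s L : ℕ} {S₁ S₂ S₃ S₄ : GTMWeihrauch.MRSet.{u} s}
    (f : GTMWeihrauch.MultiFun S₁ S₂) (g : GTMWeihrauch.MultiFun S₃ S₄)
    (Z : Fin (L + 1) → GTMWeihrauch.MRSet.{u} s)
    (N : GTMWeihrauch.GTM s (fun i => (Z i).carrier))
    -- `N` has one input tape, the sets of the input and output tapes are those of `f`,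
    -- and `f₀` is `f` as a multi-function on the sets of these tapes
    (f₀ : GTMWeihrauch.MultiFun (∀ j : Fin N.k, Z (N.inputTape j)) (Z 0))
    (hf₀ : (⟨N.k, fun j => Z (N.inputTape j), Z 0, f₀⟩ : GTMWeihrauch.MFun.{u} s) =
      GTMWeihrauch.unary f)
    (honce : N.AppliesAtMostOnce g)
    (hext : GTMWeihrauch.MultiFun.Extends N.compute f₀) :
    (¬ (GTMWeihrauch.unary g).IsComputable →
      N.TestsComputable → N.AssignsComputableOr g →
      (GTMWeihrauch.HasComputablePoint g ∨ N.AlwaysApplies g f₀.dom) →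
      GTMWeihrauch.WeihrauchLE f g) ∧
    (¬ (GTMWeihrauch.unary g).IsContinuous →
      N.TestsContinuous → N.AssignsContinuousOr g →
      GTMWeihrauch.ContWeihrauchLE f g) := by
  constructor
  · intro _ hT hA hp
    obtain ⟨p₀, hc, hp₀⟩ : ∃ p₀ : GTMWeihrauch.Seq s, Computable p₀ ∧
        ((∃ y ∈ g.dom, y ∈ S₃.rep p₀) ∨ N.AlwaysApplies g f₀.dom) := by
      rcases hp with ⟨y, hy, p, hp, hyp⟩ | hall
      · exact ⟨p, hp, Or.inl ⟨y, hy, hyp⟩⟩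
      -- On names of elements of `dom f` the default is never output, so any computable sequence
      -- will do.
      · exact ⟨fun _ => 0, Computable.const 0, Or.inr hall⟩
    obtain ⟨outG, outH, hG, hH, hred, hcomp⟩ := GTMWeihrauch.exists_reduction True hf₀ honce hext
      (fun l h => (hA l h).imp_left (GTMWeihrauch.Stmt.AssignSat.imp fun _ hc => hc.hasApprox))
      (fun l h => GTMWeihrauch.Stmt.TestSat.imp (fun _ _ ht => ht.hasApprox) (hT l h)) hp₀
    obtain ⟨hcG, hcH⟩ := hcomp trivial hc
    exact ⟨_, _, hG.seqFunComputable hcG, hH.seqFunComputable hcH, hred⟩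
  · intro hg hT hA
    obtain ⟨y, hy⟩ := GTMWeihrauch.dom_nonempty_of_not_isContinuous hg
    -- No computability of the default name is needed in the continuous half.
    obtain ⟨p₀, hp₀⟩ := S₃.surj y
    obtain ⟨outG, outH, hG, hH, hred, -⟩ := GTMWeihrauch.exists_reduction False hf₀ honce hext
      (fun l h => (hA l h).imp_left (GTMWeihrauch.Stmt.AssignSat.imp fun _ hc => hc.hasApprox))
      (fun l h => GTMWeihrauch.Stmt.TestSat.imp (fun _ _ ht => ht.hasApprox) (hT l h))
      (Or.inl ⟨y, hy, hp₀⟩)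
    exact ⟨_, _, hG.seqFunContinuous, hH.seqFunContinuous, hred⟩
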